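/- Let \(r\ge 5\) be odd and \(N=r(r-1)\). Let \(W=W(D_r)\) be the group of signed permutations of the standard basis \(e_1,\dots,e_r\) of \(\mathbb R^r\) with an even number of sign changes, with positive roots \(\Pi_+=\{e_i\pm e_j:1\le i<j\le r\}\), simple roots \(\alpha_i=e_i-e_{i+1}\) \((1\le i\le r-1)\) and \(\alpha_r=e_{r-1}+e_r\), and let \(\ell\) be the Coxeter length on \(W\), i.e. \(\ell(u)\) is the least number of reflections in simple roots whose product is \(u\). For vectors \(\rho,\eta\) write \(\rho\le\eta\) if \(\eta-\rho\in\sum_{a=1}^r\mathbb Z_{\ge0}\alpha_a\), and for \(S\subseteq\Pi_+\) put \(\operatorname{Adj}(S)=\{\gamma\in\Pi_+:\gamma\le\beta\text{ for some }\beta\in S\}\). For \(u\in W\) let \(\nu_0(u)=u(\Pi_+)\cap\Pi_+\) and \(\nu_k(u)=u(\operatorname{Adj}(\nu_{k-1}(u)))\cap\Pi_+\) for \(k\ge1\); call \(u\) rational if \(\nu_k(u)=\varnothing\) for all sufficiently large \(k\). For \(\varnothing\ne I=\{i_1<\dots<i_k\}\subseteq\{1,\dots,r-1\}\) let \(p_I\)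 be the cycle \((i_1\,i_2\,\cdots\,i_k\,r)\), and define \(c_I,d_I\in W\) by \(c_I(e_j)=-e_{p_I(j)}\) for \(j\ne r\), \(c_I(e_r)=e_{i_1}\), and \(d_I(e_j)=-e_{p_I(j)}\) for \(j\neq i_k\), \(d_I(e_{i_k})=e_r\). Then \(\ell(u)\le N\) for all \(u\in W\), and the following hold. 1. \(\displaystyle\sum_{u\text{ rational}}q^{N-\ell(u)}=1+2\sum_{n=0}^{r-2}q^{n+1}(1+q)^n\) as polynomials in \(q\). 2. \(\ell(c_I)=\ell(d_I)=N-(2r-2\min I-\#I)\) for every non-empty \(I\subseteq\{1,\dots,r-1\}\). 3. Let \(\displaystyle a_t=\sum_{n=\lceil (t-1)/2\rceil}^{\min(t-1,r-2)}\binom{n}{t-n-1}\) for \(t\ge1\), an empty sum being zero. Then exactly one rational \(u\) satisfies \(N-\ell(u)=0\), and for every integer \(t\ge1\) exactly \(2a_t\) rational elements \(u\) satisfy \(N-\ell(u)=t\). 4. The set of non-zero values of \(N-\ell(u)\), for \(u\) rational, is exactly \(\{1,2,\dots,2r-3\}\). -/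

import Mathlib

namespace TypeD

/-! The index `j : Fin r` stands for the number `j + 1` in `{1, …, r}`. -/

/-- The standard basis vector `e_{j+1}` of `ℝ^r`. -/
noncomputable def e {r : ℕ} (j : Fin r) : Fin r → ℝ := Pi.single j 1

/-- The positive roots `e_i - e_j` and `e_i + e_j`, `i < j`, of type `D_r`. -/
def posRoots (r : ℕ) : Set (Fin r → ℝ) :=
  {x | ∃ i j : Fin r, i < j ∧ (x = e i - e j ∨ x = e i + e j)}

/-- The simple roots: the differences of consecutive basis vectors, and the sum of the last two
basis vectors. -/
def simpleRoots (r : ℕ) : Set (Fin r → ℝ) :=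
  {x | ∃ i j : Fin r, (i : ℕ) + 1 = j ∧
    (x = e i - e j ∨ ((j : ℕ) + 1 = r ∧ x = e i + e j))}

/-- The root order: `ρ ≤ η` iff `η - ρ` is a sum of simple roots (with repetitions allowed, the
empty sum included). -/
def RootLE {r : ℕ} (ρ η : Fin r → ℝ) : Prop :=
  η - ρ ∈ AddSubmonoid.closure (simpleRoots r)

/-- The set of positive roots that lie below some element of `S`. -/
def adj {r : ℕ} (S : Set (Fin r → ℝ)) : Set (Fin r → ℝ) :=
  {γ | γ ∈ posRoots r ∧ ∃ β ∈ S, RootLE γ β}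

/-- The signed permutation of `ℝ^r` given by `e_j ↦ ε_j e_{σ j}`. -/
noncomputable def signedPerm {r : ℕ} (σ : Equiv.Perm (Fin r)) (ε : Fin r → ℤˣ) :
    (Fin r → ℝ) ≃ₗ[ℝ] (Fin r → ℝ) where
  toFun x := fun i => ((ε (σ.symm i) : ℤ) : ℝ) * x (σ.symm i)
  invFun y := fun j => ((ε j : ℤ) : ℝ) * y (σ j)
  map_add' x y := by
    funext i
    simp [mul_add]
  map_smul' c x := by
    funext i
    simp [mul_left_comm]
  left_inv x := by
    funext j
    rcases Int.units_eq_one_or (ε j) with h | h <;> simp [h]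
  right_inv y := by
    funext i
    rcases Int.units_eq_one_or (ε (σ.symm i)) with h | h <;> simp [h]

theorem signedPerm_e {r : ℕ} (σ : Equiv.Perm (Fin r)) (ε : Fin r → ℤˣ) (j : Fin r) :
    signedPerm σ ε (e j) = ((ε j : ℤ) : ℝ) • e (σ j) := by
  funext i
  by_cases h : i = σ j
  · subst h
    simp [signedPerm, e]
  · have h2 : σ.symm i ≠ j := fun hh => h (by simp [← hh])
    simp [signedPerm, e, h, h2]

theorem signedPerm_mul {r : ℕ} (σ τ : Equiv.Perm (Fin r)) (ε η : Fin r → ℤˣ) :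
    signedPerm σ ε * signedPerm τ η = signedPerm (σ * τ) (fun j => η j * ε (τ j)) := by
  ext x i
  simp [signedPerm, LinearEquiv.mul_apply, Equiv.Perm.mul_def]
  ring

theorem signedPerm_one {r : ℕ} : signedPerm (1 : Equiv.Perm (Fin r)) (fun _ => 1) = 1 := by
  ext x i
  simp [signedPerm, Equiv.Perm.one_def]

theorem even_neg_iff {r : ℕ} (ε : Fin r → ℤˣ) :
    Even (Finset.univ.filter (fun j => ε j = -1)).card ↔ ∏ j, ε j = 1 := by
  have h : ∏ j, ε j = (-1) ^ (Finset.univ.filter (fun j => ε j = -1)).card := by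
    rw [← Finset.prod_const, Finset.prod_filter]
    refine Finset.prod_congr rfl fun j _ => ?_
    rcases Int.units_eq_one_or (ε j) with h | h <;> simp [h]
  rw [h]
  constructor
  · exact fun h => h.neg_one_pow
  · intro h1
    by_contra h2
    rw [(Nat.not_even_iff_odd.mp h2).neg_one_pow] at h1
    exact absurd h1 (by decide)

/-- The Weyl group `W(D_r)`: the signed permutations with an even number of sign changes. -/
def weylD (r : ℕ) : Subgroup ((Fin r → ℝ) ≃ₗ[ℝ] (Fin r → ℝ)) where
  carrier := {u | ∃ (σ : Equiv.Perm (Fin r)) (ε : Fin r → ℤˣ),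
    Even (Finset.univ.filter (fun j => ε j = -1)).card ∧ u = signedPerm σ ε}
  one_mem' := ⟨1, fun _ => 1, by rw [even_neg_iff]; simp, signedPerm_one.symm⟩
  mul_mem' := by
    rintro _ _ ⟨σ, ε, hε, rfl⟩ ⟨τ, η, hη, rfl⟩
    refine ⟨σ * τ, _, ?_, signedPerm_mul σ τ ε η⟩
    rw [even_neg_iff] at *
    rw [Finset.prod_mul_distrib, hη, Equiv.prod_comp τ ε, hε, one_mul]
  inv_mem' := by
    rintro _ ⟨σ, ε, hε, rfl⟩
    refine ⟨σ⁻¹, fun j => ε (σ⁻¹ j), ?_, ?_⟩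
    · rw [even_neg_iff] at *
      rw [Equiv.prod_comp σ⁻¹ ε, hε]
    · rw [inv_eq_iff_mul_eq_one, signedPerm_mul, ← signedPerm_one]
      congr 1
      · simp
      · funext j
        simp

instance weylD_finite (r : ℕ) : Finite (weylD r) := by
  have h : (Set.range fun p : Equiv.Perm (Fin r) × (Fin r → ℤˣ) =>
      signedPerm p.1 p.2).Finite := Set.finite_range _
  refine (h.subset ?_).to_subtype
  rintro _ ⟨σ, ε, -, rfl⟩
  exact ⟨(σ, ε), rfl⟩

/-- `s` is the reflection in a simple root `α` (all roots satisfy `⟨α, α⟩ = 2`). -/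
def IsSimpleReflection {r : ℕ} (s : weylD r) : Prop :=
  ∃ α ∈ simpleRoots r, ∀ x : Fin r → ℝ, s.1 x = x - (x ⬝ᵥ α) • α

/-- The Coxeter length: the least number of simple reflections whose product is `u`. -/
noncomputable def length {r : ℕ} (u : weylD r) : ℕ :=
  sInf {n | ∃ w : List (weylD r), w.length = n ∧ (∀ s ∈ w, IsSimpleReflection s) ∧ w.prod = u}

/-- `ν_0(u) = u(Π₊) ∩ Π₊` and `ν_{k+1}(u) = u(Adj(ν_k(u))) ∩ Π₊`. -/
def nu {r : ℕ} (u : weylD r) : ℕ → Set (Fin r → ℝ)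
  | 0 => (u.1 '' posRoots r) ∩ posRoots r
  | k + 1 => (u.1 '' adj (nu u k)) ∩ posRoots r

/-- `u` is rational if `ν_k(u) = ∅` for all sufficiently large `k`. -/
def IsRational {r : ℕ} (u : weylD r) : Prop :=
  ∃ K, ∀ k ≥ K, nu u k = ∅

/-- The index standing for `r`. -/
def lastIdx {r : ℕ} (hr : Odd r) : Fin r := ⟨r - 1, Nat.sub_lt hr.pos one_pos⟩

/-- The inclusion `{1, …, r - 1} ⊆ {1, …, r}`. -/
def incl {r : ℕ} (i : Fin (r - 1)) : Fin r := Fin.castLE (Nat.sub_le r 1) i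

/-- The cycle `(i₁ i₂ ⋯ i_k r)` of `I = {i₁ < ⋯ < i_k} ⊆ {1, …, r - 1}`. -/
def cyc {r : ℕ} (hr : Odd r) (I : Finset (Fin (r - 1))) : Equiv.Perm (Fin r) :=
  ((I.sort (· ≤ ·)).map incl ++ [lastIdx hr]).formPerm

theorem even_sign {r : ℕ} (hr : Odd r) (m : Fin r) :
    Even (Finset.univ.filter
      (fun j => (if j = m then (1 : ℤˣ) else -1) = -1)).card := by
  have h : (Finset.univ.filter
      (fun j => (if j = m then (1 : ℤˣ) else -1) = -1)) = Finset.univ.erase m := by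
    ext j
    by_cases hj : j = m
    · simp [hj]
    · simp [hj]
  rw [h, Finset.card_erase_of_mem (Finset.mem_univ m), Finset.card_univ, Fintype.card_fin]
  exact hr.tsub_odd odd_one

/-- `c_I`: `e_j ↦ -e_{p_I(j)}` for `j ≠ r`, and `e_r ↦ e_{p_I(r)} = e_{i₁}`, where `p_I` is the
cycle of `I`. -/
noncomputable def cElt {r : ℕ} (hr : Odd r) (I : Finset (Fin (r - 1))) : weylD r :=
  ⟨signedPerm (cyc hr I) (fun j => if j = lastIdx hr then 1 else -1),
    _, _, even_sign hr _, rfl⟩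

/-- `d_I`: `e_j ↦ -e_{p_I(j)}` for `j ≠ i_k = max I`, and `e_{i_k} ↦ e_{p_I(i_k)} = e_r`. -/
noncomputable def dElt {r : ℕ} (hr : Odd r) (I : Finset (Fin (r - 1))) (hI : I.Nonempty) :
    weylD r :=
  ⟨signedPerm (cyc hr I) (fun j => if j = incl (I.max' hI) then 1 else -1),
    _, _, even_sign hr _, rfl⟩

/-- `a_t = ∑ binom(n, t - n - 1)` over `⌈(t - 1) / 2⌉ ≤ n ≤ min (t - 1) (r - 2)`, for `t ≥ 1`. -/
def a (r t : ℕ) : ℕ :=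
  ∑ n ∈ Finset.Icc ⌈((t : ℚ) - 1) / 2⌉₊ (min (t - 1) (r - 2)), n.choose (t - n - 1)

end TypeD

/-! The length of `u` is the number of positive roots it makes negative, so the defect N - ℓ(u)
counts the positive roots that stay positive. It remains to find the rational elements and count
these roots.

Write `u` as e_j ↦ ε_j e_{σ j}. A positive root γ with u γ positive and γ ≤ u γ has u γ in every
ν_k, so it rules out rationality; more generally so does a set of roots dominated by its own image
(`not_isRational_of_invariant`). Since r is odd and the number of minus signs is even, some sign is
plus. The obstruction and pigeonhole arguments leave exactly one plus sign, at the last index or at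
its preimage under σ (`IsRational.sign_cases`). The diagram automorphism negating e_r exchanges the
two cases and preserves rationality and length.

With the plus sign at the last index, the obstruction forces σ y ≥ y for every other y
(`IsRational.ascending`). Such a σ is determined by the points it moves, hence is the cycle p_I of
those points (`Ascending.eq_cyc`). Conversely, ascent makes u rational: ν_k consists of differences
e_a - e_b whose first index grows with k (`Ascending.isRational`). So the rational elements are the
c_I together with the d_I for I non-empty.

The defect of c_I is the number of inversions of p_I. For I non-empty, the last index accounts for r
- min I of them, and each fixed point between min I and r for one more, a total of 2(r - min I) -
#I. Grouping the sets I by their minimum gives the generating function; its coefficients give the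
remaining counts. -/

namespace TypeD

/-! ### Roots, heights and the positive cone of type D -/

variable {r : ℕ}

/-- The height functional: pairing with `(r - 1, r - 2, …, 0)`. -/
noncomputable def ht (x : Fin r → ℝ) : ℝ := (fun i : Fin r => (r : ℝ) - 1 - (i : ℕ)) ⬝ᵥ x

theorem ht_e (i : Fin r) : ht (e i) = (r : ℝ) - 1 - (i : ℕ) := by
  simp [ht, e]

theorem ht_add (x y : Fin r → ℝ) : ht (x + y) = ht x + ht y := dotProduct_add _ _ _
theorem ht_sub (x y : Fin r → ℝ) : ht (x - y) = ht x - ht y := dotProduct_sub _ _ _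
theorem ht_neg (x : Fin r → ℝ) : ht (-x) = -ht x := dotProduct_neg _ _
theorem ht_smul (c : ℝ) (x : Fin r → ℝ) : ht (c • x) = c * ht x := dotProduct_smul _ _ _

theorem e_dot (i j : Fin r) : e i ⬝ᵥ e j = if i = j then 1 else 0 := by
  simp [e, Pi.single_apply, eq_comm]

theorem e_apply (i j : Fin r) : e i j = if j = i then 1 else 0 := by
  simp [e, Pi.single_apply]

theorem sub_mem_posRoots {i j : Fin r} (h : i < j) : e i - e j ∈ posRoots r :=
  ⟨i, j, h, Or.inl rfl⟩

theorem add_mem_posRoots {i j : Fin r} (h : i ≠ j) : e i + e j ∈ posRoots r := by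
  rcases lt_or_gt_of_ne h with h | h
  · exact ⟨i, j, h, Or.inr rfl⟩
  · exact ⟨j, i, h, Or.inr (add_comm _ _)⟩

theorem one_le_ht {x : Fin r → ℝ} (hx : x ∈ posRoots r) : 1 ≤ ht x := by
  obtain ⟨i, j, hij, h⟩ := hx
  have h1 : ((i : ℕ) : ℝ) + 1 ≤ (j : ℕ) := by exact_mod_cast hij
  have h2 : ((j : ℕ) : ℝ) + 1 ≤ r := by exact_mod_cast j.2
  rcases h with rfl | rfl
  · rw [ht_sub, ht_e, ht_e]; linarith
  · rw [ht_add, ht_e, ht_e]; linarith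

theorem ht_e_nonneg (i : Fin r) : 0 ≤ ht (e i) := by
  have h2 : ((i : ℕ) : ℝ) + 1 ≤ r := by exact_mod_cast i.2
  rw [ht_e]; linarith

theorem sub_mem_posRoots_iff {i j : Fin r} : e i - e j ∈ posRoots r ↔ i < j := by
  refine ⟨fun h => ?_, sub_mem_posRoots⟩
  have := one_le_ht h
  rw [ht_sub, ht_e, ht_e] at this
  have h3 : ((i : ℕ) : ℝ) < (j : ℕ) := by linarith
  exact_mod_cast h3

theorem neg_sub_notMem_posRoots (i j : Fin r) : -e i - e j ∉ posRoots r := by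
  intro h
  have := one_le_ht h
  rw [ht_sub, ht_neg] at this
  linarith [ht_e_nonneg i, ht_e_nonneg j]

theorem neg_notMem_posRoots {x : Fin r → ℝ} (hx : x ∈ posRoots r) : -x ∉ posRoots r := by
  intro h
  have := one_le_ht h
  rw [ht_neg] at this
  linarith [one_le_ht hx]

theorem dot_self_of_mem {x : Fin r → ℝ} (hx : x ∈ posRoots r) : x ⬝ᵥ x = 2 := by
  obtain ⟨i, j, hij, h⟩ := hx
  have h1 := hij.ne
  rcases h with rfl | rfl
  · simp only [sub_dotProduct, dotProduct_sub, e_dot]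
    simp [h1, h1.symm]; norm_num
  · simp only [add_dotProduct, dotProduct_add, e_dot]
    simp [h1, h1.symm]; norm_num

theorem simpleRoots_subset : simpleRoots r ⊆ posRoots r := by
  rintro x ⟨i, j, hij, h⟩
  refine ⟨i, j, by rw [Fin.lt_def]; omega, ?_⟩
  tauto

theorem ht_simple {x : Fin r → ℝ} (hx : x ∈ simpleRoots r) : ht x = 1 := by
  obtain ⟨i, j, hij, h⟩ := hx
  have h1 : ((i : ℕ) : ℝ) + 1 = (j : ℕ) := by exact_mod_cast hij
  rcases h with rfl | ⟨hj, rfl⟩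
  · rw [ht_sub, ht_e, ht_e]; linarith
  · have h2 : ((j : ℕ) : ℝ) + 1 = r := by exact_mod_cast hj
    rw [ht_add, ht_e, ht_e]; linarith

theorem sub_mem_closure {i j : Fin r} (h : i ≤ j) :
    e i - e j ∈ AddSubmonoid.closure (simpleRoots r) := by
  obtain ⟨n, hn⟩ := Nat.exists_eq_add_of_le (Fin.le_def.mp h)
  induction n generalizing j with
  | zero =>
    obtain rfl : i = j := Fin.ext (by omega)
    simp
  | succ n ih =>
    have hj := j.2
    let k : Fin r := ⟨i + n, by omega⟩
    have h1 := ih (j := k) (Fin.le_def.mpr (by simp [k])) rfl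
    have h2 : e k - e j ∈ AddSubmonoid.closure (simpleRoots r) :=
      AddSubmonoid.subset_closure ⟨k, j, by simp [k]; omega, Or.inl rfl⟩
    simpa using add_mem h1 h2

/-- The decomposition is (e_i - e_{r-1}) + (e_j - e_r) + (e_{r-1} + e_r) in numbering from 1. It
does not require i ≠ j. -/
theorem add_mem_closure_of_lt {i : Fin r} (hi : (i : ℕ) + 1 < r) (j : Fin r) :
    e i + e j ∈ AddSubmonoid.closure (simpleRoots r) := by
  have hj := j.2
  let k : Fin r := ⟨r - 2, by omega⟩
  let l : Fin r := ⟨r - 1, by omega⟩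
  have h1 : e k + e l ∈ AddSubmonoid.closure (simpleRoots r) :=
    AddSubmonoid.subset_closure
      ⟨k, l, by simp [k, l]; omega, Or.inr ⟨by simp [l]; omega, rfl⟩⟩
  have h2 := sub_mem_closure (i := i) (j := k) (Fin.le_def.mpr (by simp [k]; omega))
  have h3 := sub_mem_closure (i := j) (j := l) (Fin.le_def.mpr (by simp [l]; omega))
  convert add_mem (add_mem h2 h3) h1 using 1
  abel

theorem posRoots_subset_closure {x : Fin r → ℝ} (hx : x ∈ posRoots r) :
    x ∈ AddSubmonoid.closure (simpleRoots r) := by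
  obtain ⟨i, j, hij, rfl | rfl⟩ := hx
  · exact sub_mem_closure hij.le
  · exact add_mem_closure_of_lt (by have := j.2; have := Fin.lt_def.mp hij; omega) j

theorem weylD_apply_mem (u : weylD r) {x : Fin r → ℝ} (hx : x ∈ posRoots r) :
    u.1 x ∈ posRoots r ∨ -u.1 x ∈ posRoots r := by
  obtain ⟨u, σ, ε, -, rfl⟩ := u
  have key : ∀ a b : Fin r, a ≠ b → e a - e b ∈ posRoots r ∨ e b - e a ∈ posRoots r := by
    intro a b hab
    rcases lt_or_gt_of_ne hab with h | h
    · exact Or.inl (sub_mem_posRoots h)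
    · exact Or.inr (sub_mem_posRoots h)
  obtain ⟨i, j, hij, rfl | rfl⟩ := hx
  all_goals
    have hne : σ i ≠ σ j := fun h => hij.ne (σ.injective h)
    have h1 := key _ _ hne
    have h2 := add_mem_posRoots hne
    simp only [map_add, map_sub, signedPerm_e]
    rcases Int.units_eq_one_or (ε i) with hi | hi <;>
    rcases Int.units_eq_one_or (ε j) with hj | hj <;>
    simp [hi, hj, ← sub_eq_add_neg, h1, h2, neg_add_eq_sub, add_comm (e (σ j)), h1.symm]

theorem exists_simpleReflection {α : Fin r → ℝ} (hα : α ∈ simpleRoots r) :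
    ∃ s : weylD r, ∀ x : Fin r → ℝ, s.1 x = x - (x ⬝ᵥ α) • α := by
  obtain ⟨i, j, hij, h⟩ := hα
  have hne : i ≠ j := by rintro rfl; omega
  have main : ∀ t : ℤˣ, ∃ s : weylD r, ∀ x : Fin r → ℝ,
      s.1 x = x - (x ⬝ᵥ (e i - ((t : ℤ) : ℝ) • e j)) • (e i - ((t : ℤ) : ℝ) • e j) := by
    intro t
    -- The roots e_i - e_j and e_i + e_j are treated together, as t = 1 and t = -1. Both swapped
    -- vectors receive the sign t, so the number of sign changes is 0 or 2.
    let ε : Fin r → ℤˣ := fun k => (if k = i then t else 1) * (if k = j then t else 1)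
    have hε : Even (Finset.univ.filter (fun j => ε j = -1)).card := by
      rw [even_neg_iff]
      simp only [ε]
      rw [Finset.prod_mul_distrib]
      simp
    refine ⟨⟨signedPerm (Equiv.swap i j) ε, _, _, hε, rfl⟩, fun x => ?_⟩
    have ht2 : ((t : ℤ) : ℝ) * ((t : ℤ) : ℝ) = 1 := by
      rcases Int.units_eq_one_or t with h | h <;> simp [h]
    have hd : x ⬝ᵥ (e i - ((t : ℤ) : ℝ) • e j) = x i - ((t : ℤ) : ℝ) * x j := by
      simp [dotProduct_sub, dotProduct_smul, e]
    funext k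
    rw [hd]
    by_cases h1 : k = i
    · subst h1
      simp [signedPerm, ε, e_apply, hne, hne.symm]
    · by_cases h2 : k = j
      · subst h2
        simp [signedPerm, ε, e_apply, hne, hne.symm]
        linear_combination (x k) * ht2
      · simp [signedPerm, ε, e_apply, h1, h2, Equiv.swap_apply_of_ne_of_ne]
  rcases h with rfl | ⟨-, rfl⟩
  · simpa using main 1
  · simpa using main (-1)

/-! ### Simple reflections and inversions -/

section Length

variable {α : Fin r → ℝ} {s : weylD r}

theorem reflection_simple (hα : α ∈ simpleRoots r)
    (hs : ∀ x : Fin r → ℝ, s.1 x = x - (x ⬝ᵥ α) • α) : s.1 α = -α := by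
  rw [hs, dot_self_of_mem (simpleRoots_subset hα), two_smul]
  abel

theorem reflection_involutive (hα : α ∈ simpleRoots r)
    (hs : ∀ x : Fin r → ℝ, s.1 x = x - (x ⬝ᵥ α) • α) (x : Fin r → ℝ) : s.1 (s.1 x) = x := by
  rw [hs x, map_sub, map_smul, reflection_simple hα hs, hs x]
  simp

theorem reflection_mul_self (hα : α ∈ simpleRoots r)
    (hs : ∀ x : Fin r → ℝ, s.1 x = x - (x ⬝ᵥ α) • α) : s * s = 1 := by
  ext1
  refine LinearEquiv.ext fun x => ?_
  exact reflection_involutive hα hs x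

/-- If s x were negative, its height ht x - ⟨x, α⟩ would be at most -1, so ⟨x, α⟩ ≥ 2. As x and α
have square length 2, this gives |x - α|² = 4 - 2⟨x, α⟩ ≤ 0 and x = α. -/
theorem reflection_mem (hα : α ∈ simpleRoots r)
    (hs : ∀ x : Fin r → ℝ, s.1 x = x - (x ⬝ᵥ α) • α) {x : Fin r → ℝ} (hx : x ∈ posRoots r)
    (hne : x ≠ α) : s.1 x ∈ posRoots r := by
  refine (weylD_apply_mem s hx).resolve_right fun h => hne ?_
  have h1 := one_le_ht h
  have h2 := one_le_ht hx
  have h3 : (x - α) ⬝ᵥ (x - α) = 4 - 2 * (x ⬝ᵥ α) := by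
    rw [sub_dotProduct, dotProduct_sub, dotProduct_sub, dot_self_of_mem hx,
      dot_self_of_mem (simpleRoots_subset hα), dotProduct_comm α x]
    ring
  have h4 : 0 ≤ (x - α) ⬝ᵥ (x - α) := Finset.sum_nonneg fun i _ => mul_self_nonneg _
  rw [hs, ht_neg, ht_sub, ht_smul, ht_simple hα] at h1
  have h5 : (x - α) ⬝ᵥ (x - α) = 0 := by linarith
  exact sub_eq_zero.mp (dotProduct_self_eq_zero.mp h5)

end Length

/-- The inversions of `u`: the positive roots that `u` makes negative. -/
def inversions (u : weylD r) : Set (Fin r → ℝ) := {x | x ∈ posRoots r ∧ u.1 x ∉ posRoots r}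

/-- The positive roots that `u` keeps positive. -/
def noninversions (u : weylD r) : Set (Fin r → ℝ) := {x | x ∈ posRoots r ∧ u.1 x ∈ posRoots r}

/-- A parametrization of the positive roots by pairs of distinct indices. -/
noncomputable def rootOfPair (p : Fin r × Fin r) : Fin r → ℝ :=
  if p.1 < p.2 then e p.1 - e p.2 else e p.1 + e p.2

theorem rootOfPair_image :
    (rootOfPair '' ((Finset.univ : Finset (Fin r)).offDiag : Set (Fin r × Fin r)))
      = posRoots r := by
  ext x
  constructor
  · rintro ⟨⟨i, j⟩, h, rfl⟩
    have hne : i ≠ j := by simpa using h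
    unfold rootOfPair
    split_ifs with h1
    · exact sub_mem_posRoots h1
    · exact add_mem_posRoots hne
  · rintro ⟨i, j, hij, rfl | rfl⟩
    · exact ⟨(i, j), by simpa using hij.ne, by simp [rootOfPair, hij]⟩
    · exact ⟨(j, i), by simpa using hij.ne', by simp [rootOfPair, hij.not_gt, add_comm]⟩

theorem sub_eq_sub_of_lt {i j k l : Fin r} (hij : i < j)
    (h : e i - e j = e k - e l) : i = k ∧ j = l := by
  have h1 := congrFun h i
  have h2 := congrFun h j
  simp only [Pi.sub_apply, e_apply, hij.ne, hij.ne', if_true, if_false] at h1 h2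
  constructor
  · by_contra hne
    rw [if_neg hne] at h1
    split_ifs at h1 <;> norm_num at h1
  · by_contra hne
    rw [if_neg hne] at h2
    split_ifs at h2 <;> norm_num at h2

theorem add_eq_add_of_lt {i j k l : Fin r} (hij : i < j) (hkl : k < l)
    (h : e i + e j = e k + e l) : i = k ∧ j = l := by
  have h1 := congrFun h i
  have h2 := congrFun h j
  simp only [Pi.add_apply, e_apply, hij.ne, hij.ne', if_true, if_false] at h1 h2
  have hi : i = k ∨ i = l := by
    by_contra! hne
    simp [hne] at h1
  have hj : j = k ∨ j = l := by
    by_contra! hne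
    simp [hne] at h2
  rcases hi with rfl | rfl <;> rcases hj with rfl | rfl
  · exact absurd hij (lt_irrefl _)
  · exact ⟨rfl, rfl⟩
  · exact absurd hij hkl.not_gt
  · exact absurd hij (lt_irrefl _)

theorem sub_ne_add {i j k l : Fin r} (hij : i < j) : e i - e j ≠ e k + e l := by
  intro h
  have h2 := congrFun h j
  simp only [Pi.add_apply, Pi.sub_apply, e_apply, hij.ne', if_true, if_false] at h2
  split_ifs at h2 <;> norm_num at h2

theorem rootOfPair_injOn :
    Set.InjOn rootOfPair ((Finset.univ : Finset (Fin r)).offDiag : Set (Fin r × Fin r)) := by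
  rintro ⟨i, j⟩ h ⟨k, l⟩ h' heq
  have hne : i ≠ j := by simpa using h
  have hne' : k ≠ l := by simpa using h'
  simp only [rootOfPair] at heq
  split_ifs at heq with h1 h2 h2
  · obtain ⟨rfl, rfl⟩ := sub_eq_sub_of_lt h1 heq
    rfl
  · exact (sub_ne_add h1 heq).elim
  · exact (sub_ne_add h2 heq.symm).elim
  · have h1 := lt_of_le_of_ne (not_lt.mp h1) hne.symm
    have h2 := lt_of_le_of_ne (not_lt.mp h2) hne'.symm
    rw [add_comm (e i), add_comm (e k)] at heq
    obtain ⟨rfl, rfl⟩ := add_eq_add_of_lt h1 h2 heq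
    rfl

theorem posRoots_finite : (posRoots r).Finite := by
  rw [← rootOfPair_image]
  exact (Finset.finite_toSet _).image _

theorem posRoots_ncard : (posRoots r).ncard = r * (r - 1) := by
  rw [← rootOfPair_image, rootOfPair_injOn.ncard_image, Set.ncard_coe_finset,
    Finset.offDiag_card]
  simp [Nat.mul_sub]

theorem inversions_finite (u : weylD r) : (inversions u).Finite :=
  posRoots_finite.subset fun _ h => h.1

theorem inversions_ncard_add (u : weylD r) :
    (inversions u).ncard + (noninversions u).ncard = r * (r - 1) := by
  rw [← posRoots_ncard, ← Set.ncard_union_eq _ (inversions_finite u)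
    (posRoots_finite.subset fun _ h => h.1)]
  · congr 1
    ext x
    simp only [inversions, noninversions, Set.mem_union, Set.mem_ofPred_eq]
    tauto
  · rw [Set.disjoint_left]
    exact fun x h1 h2 => h1.2 h2.2

section Length

variable {α : Fin r → ℝ} {s : weylD r}

/-- The reflection permutes the positive roots other than α. It therefore carries the inversions of
u to those of u s, apart from the new inversion α. -/
theorem inversions_mul_of_mem (hα : α ∈ simpleRoots r)
    (hs : ∀ x : Fin r → ℝ, s.1 x = x - (x ⬝ᵥ α) • α) (u : weylD r) (hu : u.1 α ∈ posRoots r) :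
    (inversions (u * s)).ncard = (inversions u).ncard + 1 := by
  have h0 := simpleRoots_subset hα
  have h1 : inversions (u * s) = insert α (s.1 '' inversions u) := by
    ext x
    constructor
    · rintro ⟨hx, hx'⟩
      by_cases hne : x = α
      · exact Or.inl hne
      · exact Or.inr ⟨s.1 x, ⟨reflection_mem hα hs hx hne, hx'⟩, reflection_involutive hα hs x⟩
    · rintro (rfl | ⟨y, ⟨hy, hy'⟩, rfl⟩)
      · refine ⟨h0, ?_⟩
        change u.1 (s.1 x) ∉ _
        rw [reflection_simple hα hs, map_neg]
        exact neg_notMem_posRoots hu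
      · refine ⟨reflection_mem hα hs hy (by rintro rfl; exact hy' hu), ?_⟩
        change u.1 (s.1 (s.1 y)) ∉ _
        rwa [reflection_involutive hα hs]
  rw [h1, Set.ncard_insert_of_notMem _ ((inversions_finite u).image _),
    Set.ncard_image_of_injective _ s.1.injective]
  rintro ⟨y, ⟨hy, hy'⟩, h⟩
  have : y = -α := by rw [← reflection_involutive hα hs y, h, reflection_simple hα hs]
  subst this
  exact neg_notMem_posRoots h0 hy

theorem inversions_mul_of_notMem (hα : α ∈ simpleRoots r)
    (hs : ∀ x : Fin r → ℝ, s.1 x = x - (x ⬝ᵥ α) • α) (u : weylD r) (hu : u.1 α ∉ posRoots r) :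
    (inversions u).ncard = (inversions (u * s)).ncard + 1 := by
  rw [← inversions_mul_of_mem hα hs (u * s), mul_assoc, reflection_mul_self hα hs, mul_one]
  change u.1 (s.1 α) ∈ _
  rw [reflection_simple hα hs, map_neg]
  exact (weylD_apply_mem u (simpleRoots_subset hα)).resolve_left hu

end Length

/-- Positivity passes from simple to all positive roots by height. Positivity of the images of both
e_i - e_j and e_i + e_j then fixes every sign but the last and makes σ increasing; parity fixes the
last sign. -/
theorem eq_one_of_simple (u : weylD r) (hu : ∀ α ∈ simpleRoots r, u.1 α ∈ posRoots r) :
    u = 1 := by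
  have hpos : ∀ x ∈ posRoots r, u.1 x ∈ posRoots r := by
    intro x hx
    refine (weylD_apply_mem u hx).resolve_right fun h => ?_
    have h1 : 0 ≤ ht (u.1 x) := by
      have h2 := posRoots_subset_closure hx
      clear h hx
      induction h2 using AddSubmonoid.closure_induction with
      | mem x hx => linarith [one_le_ht (hu x hx)]
      | zero => simp [ht]
      | add x y _ _ hx hy => rw [map_add, ht_add]; linarith
    have := one_le_ht h
    rw [ht_neg] at this
    linarith
  obtain ⟨u, σ, ε, hε, rfl⟩ := u
  have h1 : ∀ i j : Fin r, i < j → ε i = 1 ∧ σ i < σ j := by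
    intro i j hij
    have h1 := one_le_ht (hpos _ (sub_mem_posRoots hij))
    have h2 := one_le_ht (hpos _ (add_mem_posRoots hij.ne))
    simp only [map_add, map_sub, signedPerm_e, ht_add, ht_sub, ht_smul] at h1 h2
    have h3 := ht_e_nonneg (σ i)
    have h5 : ε i = 1 := by
      refine (Int.units_eq_one_or _).resolve_right fun h => ?_
      simp only [h] at h1 h2
      push_cast at h1 h2
      linarith
    refine ⟨h5, ?_⟩
    have h6 : ((σ i : ℕ) : ℝ) < (σ j : ℕ) := by
      simp only [h5, ht_e] at h1 h2
      rcases Int.units_eq_one_or (ε j) with h | h <;> simp [h] at h1 h2 <;> linarith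
    exact_mod_cast h6
  have hσ : σ = 1 := by
    have : StrictMono σ := fun i j h => (h1 i j h).2
    ext i
    have := congrArg (fun f => f i) (Subsingleton.elim (this.orderIsoOfSurjective _ σ.surjective)
      (OrderIso.refl _))
    simpa using congrArg Fin.val this
  have hε1 : ε = fun _ => 1 := by
    rw [even_neg_iff] at hε
    funext i
    by_cases hi : (i : ℕ) + 1 < r
    · exact (h1 i ⟨i + 1, hi⟩ (Fin.lt_def.mpr (by simp))).1
    · rw [← hε]
      symm
      refine Finset.prod_eq_single i (fun j _ hj => ?_) (by simp)
      refine (h1 j i (Fin.lt_def.mpr ?_)).1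
      have := j.2
      have : (j : ℕ) ≠ i := fun h => hj (Fin.ext h)
      omega
  ext1
  change signedPerm σ ε = 1
  rw [hσ, hε1, signedPerm_one]

theorem inversions_le_of_prod (w : List (weylD r)) (hw : ∀ s ∈ w, IsSimpleReflection s) :
    (inversions w.prod).ncard ≤ w.length := by
  induction w using List.reverseRecOn with
  | nil =>
    have : inversions (1 : weylD r) = ∅ := by
      ext x
      simp [inversions]
    simp [this]
  | append_singleton w s ih =>
    obtain ⟨α, hα, hs⟩ := hw s (by simp)
    have ih := ih fun t ht => hw t (by simp [ht])
    rw [List.prod_append, List.prod_singleton, List.length_append, List.length_singleton]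
    by_cases h : w.prod.1 α ∈ posRoots r
    · rw [inversions_mul_of_mem hα hs _ h]
      omega
    · have := inversions_mul_of_notMem hα hs _ h
      omega

theorem exists_word (n : ℕ) (u : weylD r) (hu : (inversions u).ncard = n) :
    ∃ w : List (weylD r), w.length = n ∧ (∀ s ∈ w, IsSimpleReflection s) ∧ w.prod = u := by
  induction n generalizing u with
  | zero =>
    refine ⟨[], rfl, by simp, ?_⟩
    rw [Set.ncard_eq_zero (inversions_finite u)] at hu
    refine (eq_one_of_simple u fun α hα => ?_).symm
    by_contra h
    have : α ∈ inversions u := ⟨simpleRoots_subset hα, h⟩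
    simp [hu] at this
  | succ n ih =>
    have : ∃ α ∈ simpleRoots r, u.1 α ∉ posRoots r := by
      by_contra! h
      have h1 := eq_one_of_simple u h
      have : inversions (1 : weylD r) = ∅ := by
        ext x
        simp [inversions]
      rw [h1, this] at hu
      simp at hu
    obtain ⟨α, hα, h⟩ := this
    obtain ⟨s, hs⟩ := exists_simpleReflection hα
    have h1 := inversions_mul_of_notMem hα hs u h
    obtain ⟨w, hw, hw1, hw2⟩ := ih (u * s) (by omega)
    refine ⟨w ++ [s], by simp [hw], ?_, ?_⟩
    · intro t ht
      rcases List.mem_append.mp ht with ht | ht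
      · exact hw1 t ht
      · rw [List.mem_singleton.mp ht]
        exact ⟨α, hα, hs⟩
    · rw [List.prod_append, hw2, List.prod_singleton, mul_assoc, reflection_mul_self hα hs,
        mul_one]

theorem length_eq_inversions (u : weylD r) : length u = (inversions u).ncard := by
  refine le_antisymm (Nat.sInf_le (exists_word _ u rfl)) ?_
  refine le_csInf ⟨_, exists_word _ u rfl⟩ ?_
  rintro n ⟨w, rfl, hw, rfl⟩
  exact inversions_le_of_prod w hw

theorem length_add_noninversions (u : weylD r) :
    length u + (noninversions u).ncard = r * (r - 1) := by
  rw [length_eq_inversions, inversions_ncard_add]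

/-! ### Obstructions to rationality -/

section NonRational

/-- By induction u(S) ⊆ ν_k for all k: each γ in S lies below an element of u(S), hence belongs to
Adj(ν_k). -/
theorem not_isRational_of_invariant {u : weylD r} (S : Set (Fin r → ℝ)) (hS : S.Nonempty)
    (hpos : ∀ γ ∈ S, γ ∈ posRoots r) (hu : ∀ γ ∈ S, u.1 γ ∈ posRoots r)
    (h : ∀ γ ∈ S, ∃ δ ∈ S, RootLE γ (u.1 δ)) : ¬ IsRational u := by
  rintro ⟨K, hK⟩
  have key : ∀ k, u.1 '' S ⊆ nu u k := by
    intro k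
    induction k with
    | zero =>
      rintro _ ⟨γ, hγ, rfl⟩
      exact ⟨⟨γ, hpos γ hγ, rfl⟩, hu γ hγ⟩
    | succ k ih =>
      rintro _ ⟨γ, hγ, rfl⟩
      obtain ⟨δ, hδ, hle⟩ := h γ hγ
      exact ⟨⟨γ, ⟨hpos γ hγ, u.1 δ, ih ⟨δ, hδ, rfl⟩, hle⟩, rfl⟩, hu γ hγ⟩
  obtain ⟨γ, hγ⟩ := hS
  have := key K ⟨γ, hγ, rfl⟩
  rw [hK K le_rfl] at this
  exact this

theorem not_isRational_of_rootLE {u : weylD r} {γ : Fin r → ℝ} (h1 : γ ∈ posRoots r)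
    (h2 : u.1 γ ∈ posRoots r) (h : RootLE γ (u.1 γ)) : ¬ IsRational u := by
  refine not_isRational_of_invariant {γ} ⟨γ, rfl⟩ ?_ ?_ ?_
  · rintro _ rfl; exact h1
  · rintro _ rfl; exact h2
  · rintro _ rfl; exact ⟨_, rfl, h⟩

variable {u : weylD r} {σ : Equiv.Perm (Fin r)} {ε : Fin r → ℤˣ} {i j : Fin r}

theorem rootLE_add_add {i j a b : Fin r} (h1 : a ≤ i) (h2 : b ≤ j) :
    RootLE (e i + e j) (e a + e b) := by
  have := add_mem (sub_mem_closure h1) (sub_mem_closure h2)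
  unfold RootLE
  convert this using 1
  abel

theorem rootLE_sub_sub {i j a b : Fin r} (h1 : a ≤ i) (h2 : j ≤ b) :
    RootLE (e i - e j) (e a - e b) := by
  have := add_mem (sub_mem_closure h1) (sub_mem_closure h2)
  unfold RootLE
  convert this using 1
  abel

/-- The difference is (e_a - e_i) + (e_b + e_j). The second condition excludes b = j = r, where 2e_r
is not a sum of simple roots. -/
theorem rootLE_sub_add {i j a b : Fin r} (h1 : a ≤ i) (h2 : (b : ℕ) + 1 < r ∨ (j : ℕ) + 1 < r) :
    RootLE (e i - e j) (e a + e b) := by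
  have h3 : e b + e j ∈ AddSubmonoid.closure (simpleRoots r) := by
    rcases h2 with h2 | h2
    · exact add_mem_closure_of_lt h2 j
    · rw [add_comm]
      exact add_mem_closure_of_lt h2 b
  have := add_mem (sub_mem_closure h1) h3
  unfold RootLE
  convert this using 1
  abel

theorem IsRational.not_le_of_pos_of_pos (hR : IsRational u) (hu : u.1 = signedPerm σ ε)
    (hij : i ≠ j) (hi : ε i = 1) (hj : ε j = 1) :
    ¬ (σ i ≤ i ∧ σ j ≤ j) ∧ ¬ (σ j ≤ i ∧ σ i ≤ j) := by
  have hne : σ i ≠ σ j := fun h => hij (σ.injective h)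
  have h1 : u.1 (e i + e j) = e (σ i) + e (σ j) := by
    simp [hu, signedPerm_e, hi, hj]
  constructor
  · rintro ⟨h2, h3⟩
    refine not_isRational_of_rootLE (add_mem_posRoots hij) ?_ ?_ hR
    · rw [h1]; exact add_mem_posRoots hne
    · rw [h1]; exact rootLE_add_add h2 h3
  · rintro ⟨h2, h3⟩
    refine not_isRational_of_rootLE (add_mem_posRoots hij) ?_ ?_ hR
    · rw [h1]; exact add_mem_posRoots hne
    · rw [h1, add_comm (e (σ i))]; exact rootLE_add_add h2 h3

theorem IsRational.lt_apply_of_pos_of_neg (hR : IsRational u) (hu : u.1 = signedPerm σ ε)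
    (hij : i < j) (hi : ε i = 1) (hj : ε j = -1) : i < σ i := by
  by_contra! hle
  have hne : σ i ≠ σ j := fun h => hij.ne (σ.injective h)
  have h1 : u.1 (e i - e j) = e (σ i) + e (σ j) := by
    simp [hu, signedPerm_e, hi, hj]
  by_cases h2 : (σ j : ℕ) + 1 < r ∨ (j : ℕ) + 1 < r
  · refine not_isRational_of_rootLE (sub_mem_posRoots hij) ?_ ?_ hR
    · rw [h1]; exact add_mem_posRoots hne
    · rw [h1]; exact rootLE_sub_add hle h2
  -- In the exceptional case j = σ j = r neither root need lie below its own image. But e_i - e_j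
  -- lies below the image of e_i + e_j and vice versa, so the pair is an obstruction.
  · have hσj : σ j = j := Fin.ext (by have := (σ j).2; have := j.2; omega)
    have hlt : σ i < j := lt_of_le_of_lt hle hij
    rw [hσj] at h1
    have h3 : u.1 (e i + e j) = e (σ i) - e j := by
      simp [hu, signedPerm_e, hi, hj, hσj, sub_eq_add_neg]
    refine not_isRational_of_invariant {e i - e j, e i + e j} ⟨_, Or.inl rfl⟩ ?_ ?_ ?_ hR
    · rintro _ (rfl | rfl)
      · exact sub_mem_posRoots hij
      · exact add_mem_posRoots hij.ne
    · rintro _ (rfl | rfl)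
      · rw [h1]; exact add_mem_posRoots hlt.ne
      · rw [h3]; exact sub_mem_posRoots hlt
    · rintro _ (rfl | rfl)
      · exact ⟨_, Or.inr rfl, by rw [h3]; exact rootLE_sub_sub hle le_rfl⟩
      · exact ⟨_, Or.inl rfl, by rw [h1]; exact rootLE_add_add hle le_rfl⟩

theorem IsRational.last_of_pos_of_neg (hR : IsRational u) (hu : u.1 = signedPerm σ ε)
    (hij : i < j) (hi : ε i = 1) (hj : ε j = -1) (hle : σ j ≤ i) :
    (σ i : ℕ) + 1 = r ∧ (j : ℕ) + 1 = r := by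
  have hne : σ i ≠ σ j := fun h => hij.ne (σ.injective h)
  have h1 : u.1 (e i - e j) = e (σ j) + e (σ i) := by
    simp [hu, signedPerm_e, hi, hj, add_comm]
  by_contra h2
  refine not_isRational_of_rootLE (sub_mem_posRoots hij) ?_ ?_ hR
  · rw [h1]; exact add_mem_posRoots hne.symm
  · rw [h1]
    refine rootLE_sub_add hle ?_
    have := (σ i).2
    have := j.2
    omega

theorem IsRational.not_le_of_neg_of_neg (hR : IsRational u) (hu : u.1 = signedPerm σ ε)
    (hij : i < j) (hi : ε i = -1) (hj : ε j = -1) : ¬ (σ j ≤ i ∧ j ≤ σ i) := by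
  rintro ⟨h1, h2⟩
  have h3 : u.1 (e i - e j) = e (σ j) - e (σ i) := by
    simp [hu, signedPerm_e, hi, hj, neg_add_eq_sub]
  refine not_isRational_of_rootLE (sub_mem_posRoots hij) ?_ ?_ hR
  · rw [h3]; exact sub_mem_posRoots (by order)
  · rw [h3]; exact rootLE_sub_sub h1 h2

end NonRational

/-! ### Signs and ascent of a rational element -/

theorem exists_gt_apply_le {σ : Equiv.Perm (Fin r)} {i : Fin r} (h : i < σ i) :
    ∃ j, i < j ∧ σ j ≤ i := by
  by_contra! hc
  -- Otherwise σ would inject the indices from i on into those strictly above i.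
  have h1 : (Finset.Ici i).card ≤ (Finset.Ioi i).card := by
    refine Finset.card_le_card_of_injOn σ ?_ σ.injective.injOn
    intro j hj
    have hj : i ≤ j := by simpa using hj
    rcases hj.eq_or_lt with rfl | hj
    · simpa using h
    · simpa using hc j hj
  rw [Fin.card_Ici, Fin.card_Ioi] at h1
  have := i.2
  omega

theorem exists_pos_of_odd (hr : Odd r) {ε : Fin r → ℤˣ}
    (hε : Even (Finset.univ.filter (fun j => ε j = -1)).card) : ∃ i, ε i = 1 := by
  by_contra! h
  have h1 : ∀ i, ε i = -1 := fun i => (Int.units_eq_one_or _).resolve_left (h i)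
  simp only [h1, Finset.filter_true, Finset.card_univ, Fintype.card_fin] at hε
  exact (Nat.not_even_iff_odd.mpr hr) hε

theorem le_lastIdx (hr : Odd r) (i : Fin r) : i ≤ lastIdx hr :=
  Fin.le_def.mpr (by have := i.2; simp [lastIdx]; omega)

theorem eq_lastIdx (hr : Odd r) {i : Fin r} (h : (i : ℕ) + 1 = r) : i = lastIdx hr :=
  Fin.ext (by simp [lastIdx]; omega)

theorem lt_lastIdx (hr : Odd r) {i : Fin r} (h : i ≠ lastIdx hr) : i < lastIdx hr :=
  lt_of_le_of_ne (le_lastIdx hr i) h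

/-- A rational element has exactly one positive sign, which sits on the preimage or on the image
of the last basis vector. -/
theorem IsRational.sign_cases {u : weylD r} (hR : IsRational u) (hr : Odd r)
    {σ : Equiv.Perm (Fin r)} {ε : Fin r → ℤˣ} (hu : u.1 = signedPerm σ ε)
    (hε : Even (Finset.univ.filter (fun j => ε j = -1)).card) :
    (∀ j, ε j = if j = lastIdx hr then 1 else -1) ∨
      (σ (lastIdx hr) ≠ lastIdx hr ∧ ∀ j, ε j = if σ j = lastIdx hr then 1 else -1) := by
  obtain ⟨i₀, hi₀⟩ := exists_pos_of_odd hr hε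
  have neg_of : ∀ {j}, ¬ ε j = 1 → ε j = -1 := fun h => (Int.units_eq_one_or _).resolve_left h
  -- The pair of i with the last index is used, whichever sign the latter carries.
  have hlt : ∀ i, ε i = 1 → i ≠ lastIdx hr → i < σ i := by
    intro i hi hne
    by_cases hL : ε (lastIdx hr) = 1
    · by_contra! hle
      exact (hR.not_le_of_pos_of_pos hu hne hi hL).1 ⟨hle, le_lastIdx hr _⟩
    · exact hR.lt_apply_of_pos_of_neg hu (lt_lastIdx hr hne) hi (neg_of hL)
  have hmain : ∀ i, ε i = 1 → i ≠ lastIdx hr → ε (lastIdx hr) = -1 ∧ σ i = lastIdx hr := by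
    intro i hi hne
    -- As i moves up, some j > i must come down to σ j ≤ i. By `hlt` a positive j can only be the
    -- last index, which the crossed obstruction forbids; a negative j is confined to the
    -- exceptional case.
    obtain ⟨j, hij, hj⟩ := exists_gt_apply_le (hlt i hi hne)
    by_cases hεj : ε j = 1
    · have hjL : j = lastIdx hr := by
        by_contra h
        have := hlt j hεj h
        order
      subst hjL
      exact ((hR.not_le_of_pos_of_pos hu hij.ne hi hεj).2 ⟨hj, le_lastIdx hr _⟩).elim
    · obtain ⟨h1, h2⟩ := hR.last_of_pos_of_neg hu hij hi (neg_of hεj) hj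
      obtain rfl := eq_lastIdx hr h2
      exact ⟨neg_of hεj, eq_lastIdx hr h1⟩
  by_cases hL : ε (lastIdx hr) = 1
  · left
    intro j
    split_ifs with h
    · rw [h, hL]
    · refine neg_of fun hj => ?_
      rw [(hmain j hj h).1] at hL
      exact absurd hL (by decide)
  · right
    have hi₁ : i₀ ≠ lastIdx hr := by
      rintro rfl
      exact hL hi₀
    have h0 := (hmain i₀ hi₀ hi₁).2
    refine ⟨fun h => hi₁ (σ.injective (h0.trans h.symm)), fun j => ?_⟩
    split_ifs with h
    · rwa [σ.injective (h.trans h0.symm)]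
    · refine neg_of fun hj => h (hmain j hj ?_).2
      rintro rfl
      exact hL hj

/-- No index except possibly the last one is mapped to a smaller index. -/
def Ascending (hr : Odd r) (σ : Equiv.Perm (Fin r)) : Prop := ∀ y, y ≠ lastIdx hr → y ≤ σ y

theorem IsRational.ascending {u : weylD r} (hR : IsRational u) (hr : Odd r)
    {σ : Equiv.Perm (Fin r)}
    (hu : u.1 = signedPerm σ (fun j => if j = lastIdx hr then 1 else -1)) : Ascending hr σ := by
  intro y
  induction y using WellFoundedLT.induction with
  | ind y ih =>
  intro hy
  by_contra! hlt
  -- At the least y with σ y < y, pigeonhole on the window [σ y, y] yields x < y with σ x ≥ y;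
  -- otherwise, by minimality, σ would map the window into [σ y, y). Then e_x - e_y lies below its
  -- image e_{σ y} - e_{σ x}.
  have hx : ∃ x, σ y ≤ x ∧ x < y ∧ y ≤ σ x := by
    by_contra! hc
    have h1 : (Finset.Icc (σ y) y).card ≤ (Finset.Ico (σ y) y).card := by
      refine Finset.card_le_card_of_injOn σ ?_ σ.injective.injOn
      intro x hx
      obtain ⟨h1, h2⟩ : σ y ≤ x ∧ x ≤ y := by simpa using hx
      rcases h2.eq_or_lt with rfl | h2
      · simpa using hlt
      · have h3 := ih x h2 (h2.trans_le (le_lastIdx hr y)).ne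
        have h4 := hc x h1 h2
        simp only [Finset.coe_Ico, Set.mem_Ico]
        exact ⟨h1.trans h3, h4⟩
    rw [Fin.card_Icc, Fin.card_Ico] at h1
    have := Fin.lt_def.mp hlt
    omega
  obtain ⟨x, h1, h2, h3⟩ := hx
  have hxL : x ≠ lastIdx hr := (h2.trans_le (le_lastIdx hr y)).ne
  exact hR.not_le_of_neg_of_neg hu h2 (by simp [hxL]) (by simp [hy]) ⟨h1, h3⟩

/-! ### The sign change of the last basis vector -/

/-- The sign change of the last basis vector. -/
noncomputable def flip (hr : Odd r) : (Fin r → ℝ) ≃ₗ[ℝ] (Fin r → ℝ) :=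
  signedPerm 1 (fun j => if j = lastIdx hr then -1 else 1)

theorem flip_e (hr : Odd r) (j : Fin r) :
    flip hr (e j) = if j = lastIdx hr then -e j else e j := by
  rw [flip, signedPerm_e]
  split_ifs <;> simp

theorem flip_mul_flip (hr : Odd r) : flip hr * flip hr = 1 := by
  rw [flip, signedPerm_mul, ← signedPerm_one]
  congr 1
  funext j
  by_cases h : j = lastIdx hr <;> simp [h]

theorem flip_flip (hr : Odd r) (x : Fin r → ℝ) : flip hr (flip hr x) = x :=
  congrArg (fun f => f x) (flip_mul_flip hr)

theorem flip_mul_signedPerm_mul_flip (hr : Odd r) (σ : Equiv.Perm (Fin r)) (ε : Fin r → ℤˣ) :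
    flip hr * signedPerm σ ε * flip hr = signedPerm σ (fun j =>
      (if j = lastIdx hr then -1 else 1) * ε j * (if σ j = lastIdx hr then -1 else 1)) := by
  rw [flip, signedPerm_mul, signedPerm_mul]
  congr 1
  funext j
  by_cases h1 : j = lastIdx hr <;> by_cases h2 : σ j = lastIdx hr <;> simp [h1, h2]

theorem flip_mem_posRoots (hr : Odd r) {x : Fin r → ℝ} (hx : x ∈ posRoots r) :
    flip hr x ∈ posRoots r := by
  obtain ⟨i, j, hij, rfl | rfl⟩ := hx
  all_goals
    have hi : i ≠ lastIdx hr := (hij.trans_le (le_lastIdx hr j)).ne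
    by_cases hj : j = lastIdx hr
    all_goals simp [flip_e, hi, hj]
  · exact add_mem_posRoots hi
  · exact sub_mem_posRoots hij
  · rw [← sub_eq_add_neg]
    exact sub_mem_posRoots (lt_lastIdx hr hi)
  · exact add_mem_posRoots hij.ne

theorem flip_mem_posRoots_iff (hr : Odd r) {x : Fin r → ℝ} :
    flip hr x ∈ posRoots r ↔ x ∈ posRoots r :=
  ⟨fun h => by simpa [flip_flip] using flip_mem_posRoots hr h, flip_mem_posRoots hr⟩

/-- This is the diagram automorphism: it exchanges e_{r-1} - e_r with e_{r-1} + e_r and fixes the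
other simple roots. Hence it respects the root order. -/
theorem flip_mem_simpleRoots (hr : Odd r) {x : Fin r → ℝ} (hx : x ∈ simpleRoots r) :
    flip hr x ∈ simpleRoots r := by
  obtain ⟨i, j, hij, h⟩ := hx
  refine ⟨i, j, hij, ?_⟩
  have hi : i ≠ lastIdx hr := by
    rintro rfl
    have := j.2
    simp [lastIdx] at hij
    omega
  by_cases hj : j = lastIdx hr
  · have hjr : (j : ℕ) + 1 = r := by
      have := hr.pos
      simp [hj, lastIdx]
      omega
    rcases h with rfl | ⟨-, rfl⟩
    · exact Or.inr ⟨hjr, by rw [map_sub, flip_e, flip_e, if_neg hi, if_pos hj, sub_neg_eq_add]⟩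
    · exact Or.inl (by rw [map_add, flip_e, flip_e, if_neg hi, if_pos hj, sub_eq_add_neg])
  · rcases h with rfl | ⟨hjr, rfl⟩
    · exact Or.inl (by rw [map_sub, flip_e, flip_e, if_neg hi, if_neg hj])
    · exact absurd (eq_lastIdx hr hjr) hj

theorem flip_mem_closure (hr : Odd r) {x : Fin r → ℝ}
    (hx : x ∈ AddSubmonoid.closure (simpleRoots r)) :
    flip hr x ∈ AddSubmonoid.closure (simpleRoots r) := by
  induction hx using AddSubmonoid.closure_induction with
  | mem x hx => exact AddSubmonoid.subset_closure (flip_mem_simpleRoots hr hx)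
  | zero => simp
  | add x y _ _ hx hy => rw [map_add]; exact add_mem hx hy

theorem prod_flip_sign (hr : Odd r) (σ : Equiv.Perm (Fin r)) :
    ∏ j, (if σ j = lastIdx hr then -1 else 1 : ℤˣ) = -1 := by
  rw [Equiv.prod_comp σ (fun j => if j = lastIdx hr then -1 else 1 : Fin r → ℤˣ)]
  simp

/-- Conjugation by the sign change of the last basis vector. -/
noncomputable def flipConj (hr : Odd r) (u : weylD r) : weylD r :=
  ⟨flip hr * u.1 * flip hr, by
    obtain ⟨u, σ, ε, hε, rfl⟩ := u
    refine ⟨σ, _, ?_, flip_mul_signedPerm_mul_flip hr σ ε⟩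
    rw [even_neg_iff] at *
    rw [Finset.prod_mul_distrib, Finset.prod_mul_distrib, hε, prod_flip_sign]
    simp⟩

theorem flipConj_apply (hr : Odd r) (u : weylD r) (x : Fin r → ℝ) :
    (flipConj hr u).1 x = flip hr (u.1 (flip hr x)) := rfl

theorem flipConj_flipConj (hr : Odd r) (u : weylD r) : flipConj hr (flipConj hr u) = u := by
  ext1
  refine LinearEquiv.ext fun x => ?_
  rw [flipConj_apply, flipConj_apply, flip_flip, flip_flip]

theorem nu_flipConj_subset (hr : Odd r) (u : weylD r) (k : ℕ) :
    nu (flipConj hr u) k ⊆ flip hr '' nu u k := by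
  induction k with
  | zero =>
    rintro _ ⟨⟨x, hx, rfl⟩, h⟩
    rw [flipConj_apply] at h ⊢
    exact ⟨_, ⟨⟨_, flip_mem_posRoots hr hx, rfl⟩, (flip_mem_posRoots_iff hr).mp h⟩, rfl⟩
  | succ k ih =>
    rintro _ ⟨⟨x, ⟨hx, β, hβ, hle⟩, rfl⟩, h⟩
    obtain ⟨β, hβ', rfl⟩ := ih hβ
    rw [flipConj_apply] at h ⊢
    refine ⟨_, ⟨⟨_, ⟨flip_mem_posRoots hr hx, β, hβ', ?_⟩, rfl⟩,
      (flip_mem_posRoots_iff hr).mp h⟩, rfl⟩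
    have := flip_mem_closure hr hle
    rwa [map_sub, flip_flip] at this

theorem IsRational.flipConj (hr : Odd r) {u : weylD r} (hR : IsRational u) :
    IsRational (flipConj hr u) := by
  obtain ⟨K, hK⟩ := hR
  refine ⟨K, fun k hk => ?_⟩
  have := nu_flipConj_subset hr u k
  rw [hK k hk, Set.image_empty] at this
  exact Set.subset_empty_iff.mp this

theorem noninversions_flipConj (hr : Odd r) (u : weylD r) :
    noninversions (flipConj hr u) = flip hr '' noninversions u := by
  ext x
  constructor
  · rintro ⟨h1, h2⟩
    rw [flipConj_apply] at h2
    exact ⟨_, ⟨flip_mem_posRoots hr h1, (flip_mem_posRoots_iff hr).mp h2⟩, flip_flip hr x⟩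
  · rintro ⟨x, ⟨h1, h2⟩, rfl⟩
    refine ⟨flip_mem_posRoots hr h1, ?_⟩
    rw [flipConj_apply, flip_flip]
    exact flip_mem_posRoots hr h2

theorem noninversions_flipConj_ncard (hr : Odd r) (u : weylD r) :
    (noninversions (flipConj hr u)).ncard = (noninversions u).ncard := by
  rw [noninversions_flipConj, Set.ncard_image_of_injective _ (flip hr).injective]

/-! ### Permutations that ascend off the last index -/

namespace Ascending

variable {hr : Odd r} {σ σ' : Equiv.Perm (Fin r)}

/-- Only the last index can descend, so values at most c come from indices at most c or from the
last index. Two indices leaving the initial segment up to c would leave too few preimages for those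
values. -/
theorem crossing_unique (h : Ascending hr σ) {c x y : Fin r} (hxy : x < y)
    (hyc : y ≤ c) (hx : c < σ x) (hy : c < σ y) : False := by
  have h1 : (Finset.Iic c).card ≤
      (insert (lastIdx hr) (((Finset.Iic c).erase x).erase y)).card := by
    refine Finset.card_le_card_of_injOn σ.symm ?_ σ.symm.injective.injOn
    intro w hw
    obtain ⟨z, rfl⟩ := σ.surjective w
    have hw : σ z ≤ c := by simpa using hw
    simp only [Equiv.symm_apply_apply, Finset.coe_insert, Finset.coe_erase, Set.mem_insert_iff,
      Set.mem_sdiff, Finset.coe_Iic, Set.mem_Iic, Set.mem_singleton_iff]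
    by_cases hz : z = lastIdx hr
    · exact Or.inl hz
    · refine Or.inr ⟨⟨(h z hz).trans hw, ?_⟩, ?_⟩ <;> rintro rfl <;> order
  have h2 := Finset.card_insert_le (lastIdx hr) (((Finset.Iic c).erase x).erase y)
  have h3 : x ∈ Finset.Iic c := by simpa using hxy.le.trans hyc
  have h4 : y ∈ (Finset.Iic c).erase x := by simpa using ⟨hxy.ne', hyc⟩
  have h5 := Finset.card_erase_add_one h3
  have h6 := Finset.card_erase_add_one h4
  omega

theorem fixed_of_inversion (h : Ascending hr σ) {x y : Fin r} (hy : y ≠ lastIdx hr) (hxy : x < y)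
    (hσ : y < σ x) : σ y = y := by
  by_contra hne
  exact h.crossing_unique hxy le_rfl hσ (lt_of_le_of_ne (h y hy) (Ne.symm hne))

/-- The last index enters the initial segment up to y, so some index must leave it. -/
theorem exists_crossing (σ : Equiv.Perm (Fin r)) {y : Fin r} (hy : y ≠ lastIdx hr)
    (hσ : σ (lastIdx hr) ≤ y) : ∃ x ≤ y, y < σ x := by
  by_contra! hc
  have h1 : (insert (lastIdx hr) (Finset.Iic y)).card ≤ (Finset.Iic y).card := by
    refine Finset.card_le_card_of_injOn σ ?_ σ.injective.injOn
    intro w hw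
    simp only [Finset.coe_insert, Set.mem_insert_iff, Finset.coe_Iic, Set.mem_Iic] at hw ⊢
    rcases hw with rfl | hw
    · exact hσ
    · exact hc w hw
  rw [Finset.card_insert_of_notMem] at h1
  · omega
  · simpa using lt_lastIdx hr hy

theorem apply_le_of_lt (h : Ascending hr σ) {c x : Fin r} (hc : c < σ (lastIdx hr))
    (hx : x ≤ c) : σ x ≤ c := by
  by_contra! hlt
  have h1 : (Finset.Iic c).card ≤ ((Finset.Iic c).erase x).card := by
    refine Finset.card_le_card_of_injOn σ.symm ?_ σ.symm.injective.injOn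
    intro w hw
    obtain ⟨z, rfl⟩ := σ.surjective w
    have hw : σ z ≤ c := by simpa using hw
    simp only [Equiv.symm_apply_apply, Finset.coe_erase, Set.mem_sdiff, Finset.coe_Iic,
      Set.mem_Iic, Set.mem_singleton_iff]
    have hz : z ≠ lastIdx hr := by rintro rfl; order
    exact ⟨(h z hz).trans hw, by rintro rfl; order⟩
  have h5 := Finset.card_erase_add_one (s := Finset.Iic c) (a := x) (by simpa using hx)
  omega

theorem fixed_of_lt (h : Ascending hr σ) {y : Fin r} (hy : y < σ (lastIdx hr)) : σ y = y :=
  le_antisymm (h.apply_le_of_lt hy le_rfl) (h y (hy.trans_le (le_lastIdx hr _)).ne)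

/-- If σ' x < σ x, then y = σ' x is jumped over by σ, hence fixed by σ and so by σ'. Injectivity of
σ' then gives σ' x = x. -/
theorem apply_le_apply (h : Ascending hr σ)
    (hm : ∀ y, y ≠ lastIdx hr → σ y = y → σ' y = y) {x : Fin r}
    (hx : σ' x ≠ x) (hxL : x ≠ lastIdx hr) (h' : Ascending hr σ') : σ x ≤ σ' x := by
  by_contra! hlt
  have h1 : x < σ' x := lt_of_le_of_ne (h' x hxL) hx.symm
  have h2 : σ' x ≠ lastIdx hr := (hlt.trans_le (le_lastIdx hr _)).ne
  exact hx (σ'.injective (hm _ h2 (h.fixed_of_inversion h2 h1 hlt)))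

theorem ext (h : Ascending hr σ) (h' : Ascending hr σ')
    (hm : ∀ y, y ≠ lastIdx hr → (σ y = y ↔ σ' y = y)) : σ = σ' := by
  have h1 : ∀ x, x ≠ lastIdx hr → σ x = σ' x := by
    intro x hx
    by_cases hf : σ x = x
    · rw [hf, (hm x hx).mp hf]
    · exact le_antisymm
        (h.apply_le_apply (fun y hy => (hm y hy).mp) (mt (hm x hx).mpr hf) hx h')
        (h'.apply_le_apply (fun y hy => (hm y hy).mpr) hf hx h)
  ext1 x
  by_cases hx : x = lastIdx hr
  · subst hx
    obtain ⟨z, hz⟩ := σ'.surjective (σ (lastIdx hr))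
    by_cases hzL : z = lastIdx hr
    · rw [← hz, hzL]
    · exact absurd (σ.injective ((h1 z hzL).trans hz)) hzL
  · exact h1 x hx

end Ascending

/-! ### The cycles of subsets -/

theorem incl_lt_lastIdx (hr : Odd r) (i : Fin (r - 1)) : incl i < lastIdx hr := i.2

theorem incl_injective : Function.Injective (incl : Fin (r - 1) → Fin r) :=
  Fin.castLE_injective (Nat.sub_le r 1)

theorem incl_lt_incl {i j : Fin (r - 1)} : incl i < incl j ↔ i < j := Iff.rfl

theorem exists_incl (hr : Odd r) {y : Fin r} (hy : y ≠ lastIdx hr) : ∃ i, incl i = y :=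
  ⟨⟨y, lt_lastIdx hr hy⟩, rfl⟩

/-- The indices below the last one that `σ` moves. -/
def moved (σ : Equiv.Perm (Fin r)) : Finset (Fin (r - 1)) :=
  Finset.univ.filter fun i => σ (incl i) ≠ incl i

theorem mem_moved {σ : Equiv.Perm (Fin r)} {i : Fin (r - 1)} :
    i ∈ moved σ ↔ σ (incl i) ≠ incl i := by
  simp [moved]

theorem cyc_list_pairwise (hr : Odd r) (I : Finset (Fin (r - 1))) :
    ((I.sort (· ≤ ·)).map incl ++ [lastIdx hr]).Pairwise (· < ·) := by
  rw [List.pairwise_append]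
  refine ⟨?_, List.pairwise_singleton _ _, ?_⟩
  · rw [List.pairwise_map]
    exact (Finset.sortedLT_sort I).pairwise
  · intro a ha b hb
    obtain ⟨i, -, rfl⟩ := List.mem_map.mp ha
    rw [List.mem_singleton.mp hb]
    exact incl_lt_lastIdx hr i

theorem cyc_apply_of_notMem (hr : Odd r) {I : Finset (Fin (r - 1))} {i : Fin (r - 1)}
    (hi : i ∉ I) : cyc hr I (incl i) = incl i := by
  refine List.formPerm_apply_of_notMem ?_
  simp only [List.mem_append, List.mem_map, Finset.mem_sort, List.mem_singleton, not_or]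
  refine ⟨?_, (incl_lt_lastIdx hr i).ne⟩
  rintro ⟨j, hj, hji⟩
  exact hi (incl_injective hji ▸ hj)

theorem lt_cyc_apply_of_mem (hr : Odd r) {I : Finset (Fin (r - 1))} {i : Fin (r - 1)}
    (hi : i ∈ I) : incl i < cyc hr I (incl i) := by
  have hp := cyc_list_pairwise hr I
  have hmem : incl i ∈ (I.sort (· ≤ ·)).map incl :=
    List.mem_map.mpr ⟨i, (Finset.mem_sort _).mpr hi, rfl⟩
  obtain ⟨n, hn, hni⟩ := List.getElem_of_mem hmem
  set l := (I.sort (· ≤ ·)).map incl with hl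
  have hn1 : n + 1 < (l ++ [lastIdx hr]).length := by
    rw [List.length_append, List.length_singleton]
    omega
  have h1 : (l ++ [lastIdx hr])[n]'(by omega) = incl i := by
    rw [List.getElem_append_left hn, hni]
  have h2 := List.formPerm_apply_lt_getElem (l ++ [lastIdx hr]) (hp.imp fun h => h.ne) n hn1
  rw [h1] at h2
  rw [cyc, h2, ← h1]
  exact List.pairwise_iff_getElem.mp hp n (n + 1) (by omega) hn1 (by omega)

theorem cyc_ascending (hr : Odd r) (I : Finset (Fin (r - 1))) : Ascending hr (cyc hr I) := by
  intro y hy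
  obtain ⟨i, rfl⟩ := exists_incl hr hy
  by_cases hi : i ∈ I
  · exact (lt_cyc_apply_of_mem hr hi).le
  · rw [cyc_apply_of_notMem hr hi]

theorem moved_cyc (hr : Odd r) (I : Finset (Fin (r - 1))) : moved (cyc hr I) = I := by
  ext i
  rw [mem_moved]
  by_cases hi : i ∈ I
  · simp [hi, (lt_cyc_apply_of_mem hr hi).ne']
  · simp [hi, cyc_apply_of_notMem hr hi]

theorem Ascending.eq_cyc {hr : Odd r} {σ : Equiv.Perm (Fin r)} (h : Ascending hr σ) :
    σ = cyc hr (moved σ) := by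
  refine h.ext (cyc_ascending hr _) fun y hy => ?_
  obtain ⟨i, rfl⟩ := exists_incl hr hy
  have := Finset.ext_iff.mp (moved_cyc hr (moved σ)) i
  rw [mem_moved, mem_moved] at this
  tauto

theorem cyc_lastIdx (hr : Odd r) {I : Finset (Fin (r - 1))} (hI : I.Nonempty) :
    cyc hr I (lastIdx hr) = incl (I.min' hI) := by
  have h := cyc_ascending hr I
  have h1 : ∀ i ∈ I, cyc hr I (lastIdx hr) ≤ incl i := by
    intro i hi
    by_contra! hlt
    exact (lt_cyc_apply_of_mem hr hi).ne' (h.fixed_of_lt hlt)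
  have h2 : cyc hr I (lastIdx hr) ≠ lastIdx hr := by
    obtain ⟨i, hi⟩ := hI
    exact ((h1 i hi).trans_lt (incl_lt_lastIdx hr i)).ne
  obtain ⟨j, hj⟩ := exists_incl hr h2
  have h3 : j ∈ I := by
    by_contra hc
    have := cyc_apply_of_notMem hr hc
    rw [hj] at this
    exact h2 ((cyc hr I).injective this)
  rw [← hj]
  congr 1
  refine le_antisymm (Finset.le_min' _ _ _ fun i hi => ?_) (Finset.min'_le _ _ h3)
  have := h1 i hi
  rwa [← hj] at this

theorem cyc_apply_eq_lastIdx_iff (hr : Odd r) {I : Finset (Fin (r - 1))} (hI : I.Nonempty)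
    (j : Fin r) : cyc hr I j = lastIdx hr ↔ j = incl (I.max' hI) := by
  -- The maximum of I strictly ascends. Any image other than the last index would lie outside I and
  -- be fixed, contradicting injectivity.
  have key : cyc hr I (incl (I.max' hI)) = lastIdx hr := by
    by_contra hne
    have h1 := lt_cyc_apply_of_mem hr (I.max'_mem hI)
    obtain ⟨k, hk⟩ := exists_incl hr hne
    rw [← hk, incl_lt_incl] at h1
    have hkI : k ∉ I := fun hkI => (I.le_max' k hkI).not_gt h1
    have := cyc_apply_of_notMem hr hkI
    rw [hk] at this
    have := (cyc hr I).injective this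
    rw [← hk] at this
    exact h1.ne' (incl_injective this)
  rw [← key]
  exact (cyc hr I).injective.eq_iff

theorem cyc_empty (hr : Odd r) : cyc hr (∅ : Finset (Fin (r - 1))) = 1 := by
  simp [cyc]

theorem sign_mul_sign_left (p q : Prop) [Decidable p] [Decidable q] :
    ((if p then -1 else 1) * (if p then 1 else -1) * (if q then -1 else 1) : ℤˣ) =
      if q then 1 else -1 := by
  by_cases p <;> by_cases q <;> simp [*]

theorem sign_mul_sign_right (p q : Prop) [Decidable p] [Decidable q] :
    ((if p then -1 else 1) * (if q then 1 else -1) * (if q then -1 else 1) : ℤˣ) =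
      if p then 1 else -1 := by
  by_cases p <;> by_cases q <;> simp [*]

theorem cElt_val (hr : Odd r) (I : Finset (Fin (r - 1))) :
    (cElt hr I).1 = signedPerm (cyc hr I) (fun j => if j = lastIdx hr then 1 else -1) := rfl

theorem dElt_val (hr : Odd r) (I : Finset (Fin (r - 1))) (hI : I.Nonempty) :
    (dElt hr I hI).1 =
      signedPerm (cyc hr I) (fun j => if j = incl (I.max' hI) then 1 else -1) := rfl

theorem flipConj_val (hr : Odd r) (u : weylD r) :
    (flipConj hr u).1 = flip hr * u.1 * flip hr := rfl

theorem dElt_eq_flipConj (hr : Odd r) {I : Finset (Fin (r - 1))} (hI : I.Nonempty) :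
    dElt hr I hI = flipConj hr (cElt hr I) := by
  ext1
  rw [dElt_val, flipConj_val, cElt_val, flip_mul_signedPerm_mul_flip]
  congr 1
  funext j
  simp only [cyc_apply_eq_lastIdx_iff hr hI j]
  exact (sign_mul_sign_left _ _).symm

/-! ### Rationality of the listed elements -/

/-- The sum of the coordinates up to `m`. -/
noncomputable def prefixSum (m : Fin r) (x : Fin r → ℝ) : ℝ :=
  (fun i => if i ≤ m then (1 : ℝ) else 0) ⬝ᵥ x

theorem prefixSum_e (m i : Fin r) : prefixSum m (e i) = if i ≤ m then 1 else 0 := by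
  simp [prefixSum, e]

theorem prefixSum_add (m : Fin r) (x y : Fin r → ℝ) :
    prefixSum m (x + y) = prefixSum m x + prefixSum m y := dotProduct_add _ _ _

theorem prefixSum_sub (m : Fin r) (x y : Fin r → ℝ) :
    prefixSum m (x - y) = prefixSum m x - prefixSum m y := dotProduct_sub _ _ _

theorem prefixSum_nonneg {x : Fin r → ℝ} (hx : x ∈ AddSubmonoid.closure (simpleRoots r))
    (m : Fin r) : 0 ≤ prefixSum m x := by
  induction hx using AddSubmonoid.closure_induction with
  | mem x hx =>
    obtain ⟨i, j, hij, h⟩ := hx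
    have hlt : i < j := by rw [Fin.lt_def]; omega
    rcases h with rfl | ⟨-, rfl⟩
    · rw [prefixSum_sub, prefixSum_e, prefixSum_e]
      split_ifs with h1 h2 <;> first | (norm_num; done) | (exfalso; order)
    · rw [prefixSum_add, prefixSum_e, prefixSum_e]
      positivity
  | zero => simp [prefixSum]
  | add x y _ _ hx hy => rw [prefixSum_add]; exact add_nonneg hx hy

theorem not_rootLE_add_sub (hr : Odd r) (i j a b : Fin r) :
    ¬ RootLE (e i + e j) (e a - e b) := by
  intro h
  have := prefixSum_nonneg h (lastIdx hr)
  simp only [prefixSum_sub, prefixSum_add, prefixSum_e, le_lastIdx, if_true] at this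
  norm_num at this

theorem le_of_rootLE_sub_sub {i j a b : Fin r} (hij : i < j) (h : RootLE (e i - e j) (e a - e b)) :
    a ≤ i := by
  by_contra! hlt
  have := prefixSum_nonneg h i
  simp only [prefixSum_sub, prefixSum_e, le_refl, hij.not_ge, hlt.not_ge, if_true,
    if_false] at this
  split_ifs at this <;> norm_num at this

/-- The action on differences of an element with the signs of `c_I`. -/
theorem signed_apply_sub {hr : Odd r} {u : weylD r} {σ : Equiv.Perm (Fin r)}
    (hu : u.1 = signedPerm σ (fun j => if j = lastIdx hr then 1 else -1)) {i j : Fin r}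
    (hij : i < j) : u.1 (e i - e j) =
      if j = lastIdx hr then -e (σ i) - e (σ j) else e (σ j) - e (σ i) := by
  have hi : i ≠ lastIdx hr := (hij.trans_le (le_lastIdx hr j)).ne
  split_ifs with hj <;> simp [hu, signedPerm_e, hi, hj, neg_add_eq_sub]

theorem signed_apply_add {hr : Odd r} {u : weylD r} {σ : Equiv.Perm (Fin r)}
    (hu : u.1 = signedPerm σ (fun j => if j = lastIdx hr then 1 else -1)) {i j : Fin r}
    (hij : i < j) : u.1 (e i + e j) =
      if j = lastIdx hr then e (σ j) - e (σ i) else -e (σ i) - e (σ j) := by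
  have hi : i ≠ lastIdx hr := (hij.trans_le (le_lastIdx hr j)).ne
  split_ifs with hj <;> simp [hu, signedPerm_e, hi, hj, neg_add_eq_sub, ← sub_eq_add_neg]

theorem Ascending.isRational {hr : Odd r} {u : weylD r} {σ : Equiv.Perm (Fin r)}
    (h : Ascending hr σ)
    (hu : u.1 = signedPerm σ (fun j => if j = lastIdx hr then 1 else -1)) : IsRational u := by
  -- Sum roots drop out because they have coordinate sum 2 and differences have 0. If e_i - e_j ≤
  -- e_a - e_b has positive image e_{σ j} - e_{σ i}, then (i, j) is an inversion, so σ j = j > i ≥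
  -- a: the first index strictly increases.
  have key : ∀ k, ∀ β ∈ nu u k, ∃ a b : Fin r, a < b ∧ k ≤ (a : ℕ) ∧ β = e a - e b := by
    intro k
    induction k with
    | zero =>
      rintro _ ⟨⟨γ, ⟨i, j, hij, rfl | rfl⟩, rfl⟩, hβ⟩
      · rw [signed_apply_sub hu hij] at hβ ⊢
        split_ifs at hβ ⊢ with hj
        · exact absurd hβ (neg_sub_notMem_posRoots _ _)
        · exact ⟨_, _, sub_mem_posRoots_iff.mp hβ, Nat.zero_le _, rfl⟩
      · rw [signed_apply_add hu hij] at hβ ⊢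
        split_ifs at hβ ⊢ with hj
        · exact ⟨_, _, sub_mem_posRoots_iff.mp hβ, Nat.zero_le _, rfl⟩
        · exact absurd hβ (neg_sub_notMem_posRoots _ _)
    | succ k ih =>
      rintro _ ⟨⟨γ, ⟨⟨i, j, hij, rfl | rfl⟩, η, hη, hle⟩, rfl⟩, hβ⟩
      · obtain ⟨a, b, hab, hka, rfl⟩ := ih η hη
        have hai := le_of_rootLE_sub_sub hij hle
        rw [signed_apply_sub hu hij] at hβ ⊢
        split_ifs at hβ ⊢ with hj
        · exact absurd hβ (neg_sub_notMem_posRoots _ _)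
        · have h1 := sub_mem_posRoots_iff.mp hβ
          have h2 := h j hj
          rw [h.fixed_of_inversion hj hij (by order)] at h1 ⊢
          refine ⟨_, _, h1, ?_, rfl⟩
          have := Fin.lt_def.mp hij
          have := Fin.le_def.mp hai
          omega
      · obtain ⟨a, b, -, -, rfl⟩ := ih η hη
        exact absurd hle (not_rootLE_add_sub hr _ _ _ _)
  refine ⟨r, fun k hk => Set.eq_empty_of_forall_notMem fun β hβ => ?_⟩
  obtain ⟨a, -, -, hka, -⟩ := key k β hβ
  have := a.2
  omega

theorem isRational_cElt (hr : Odd r) (I : Finset (Fin (r - 1))) : IsRational (cElt hr I) :=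
  (cyc_ascending hr I).isRational rfl

theorem isRational_dElt (hr : Odd r) (I : Finset (Fin (r - 1))) (hI : I.Nonempty) :
    IsRational (dElt hr I hI) := by
  rw [dElt_eq_flipConj]
  exact (isRational_cElt hr I).flipConj hr

theorem eq_cElt {hr : Odd r} {u : weylD r} {σ : Equiv.Perm (Fin r)} (hR : IsRational u)
    (hu : u.1 = signedPerm σ (fun j => if j = lastIdx hr then 1 else -1)) :
    u = cElt hr (moved σ) := by
  ext1
  rw [hu]
  conv_lhs => rw [(hR.ascending hr hu).eq_cyc]
  rfl

/-- The classification of the rational elements. -/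
theorem isRational_iff (hr : Odd r) (u : weylD r) :
    IsRational u ↔ (∃ I, u = cElt hr I) ∨ ∃ I hI, u = dElt hr I hI := by
  constructor
  · intro hR
    obtain ⟨u, σ, ε, hε, rfl⟩ := u
    rcases hR.sign_cases hr rfl hε with h | ⟨hL, h⟩
    · obtain rfl := funext h
      exact Or.inl ⟨_, eq_cElt hR rfl⟩
    · obtain rfl := funext h
      have h1 : (flipConj hr ⟨signedPerm σ _, σ, _, hε, rfl⟩).1 =
          signedPerm σ (fun j => if j = lastIdx hr then 1 else -1) := by
        rw [flipConj_val, flip_mul_signedPerm_mul_flip]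
        congr 1
        funext j
        exact sign_mul_sign_right _ _
      have h2 := eq_cElt (hR.flipConj hr) h1
      have hI : (moved σ).Nonempty := by
        by_contra hne
        rw [Finset.not_nonempty_iff_eq_empty] at hne
        have h3 := ((hR.flipConj hr).ascending hr h1).eq_cyc
        rw [hne, cyc_empty] at h3
        exact hL (by simp [h3])
      refine Or.inr ⟨moved σ, hI, ?_⟩
      rw [dElt_eq_flipConj, ← h2, flipConj_flipConj]
  · rintro (⟨I, rfl⟩ | ⟨I, hI, rfl⟩)
    · exact isRational_cElt hr I
    · exact isRational_dElt hr I hI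

/-! ### Lengths of the listed elements -/

theorem Ascending.card_inversions_at {hr : Odd r} {σ : Equiv.Perm (Fin r)} (h : Ascending hr σ)
    (y : Fin r) : (Finset.univ.filter fun x => x < y ∧ σ y < σ x).card =
      (if y = lastIdx hr then (lastIdx hr : ℕ) - σ (lastIdx hr) else 0) +
      (if y ≠ lastIdx hr ∧ σ (lastIdx hr) ≤ y ∧ σ y = y then 1 else 0) := by
  by_cases hy : y = lastIdx hr
  · subst hy
    -- Every value above that of the last index is attained earlier.
    have : (Finset.univ.filter fun x => x < lastIdx hr ∧ σ (lastIdx hr) < σ x).card =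
        (Finset.Ioi (σ (lastIdx hr))).card := by
      refine Finset.card_equiv σ fun x => ?_
      simp only [Finset.mem_filter, Finset.mem_univ, true_and, Finset.mem_Ioi,
        and_iff_right_iff_imp]
      intro hx
      refine lt_lastIdx hr ?_
      rintro rfl
      exact lt_irrefl _ hx
    rw [this, Fin.card_Ioi]
    simp [lastIdx]
  · rw [if_neg hy, zero_add]
    split_ifs with hc
    · obtain ⟨-, hle, hf⟩ := hc
      -- A fixed point reached by the cycle's span is jumped over by exactly one index:
      -- `exists_crossing` supplies it and `crossing_unique` excludes a second.
      obtain ⟨x, hx, hxy⟩ := exists_crossing σ hy hle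
      rw [Finset.card_eq_one]
      have hne : x ≠ y := by
        rintro rfl
        exact hxy.ne' hf
      refine ⟨x, Finset.eq_singleton_iff_unique_mem.mpr ⟨?_, ?_⟩⟩
      · simpa [hf, hxy] using lt_of_le_of_ne hx hne
      · intro z hz
        obtain ⟨hz1, hz2⟩ : z < y ∧ σ y < σ z := by simpa using hz
        rw [hf] at hz2
        by_contra hzx
        rcases lt_or_gt_of_ne hzx with hlt | hlt
        · exact h.crossing_unique hlt hx hz2 hxy
        · exact h.crossing_unique hlt hz1.le hxy hz2
    · rw [Finset.card_eq_zero, Finset.filter_eq_empty_iff]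
      rintro x - ⟨hxy, hσ⟩
      have hyσ := h y hy
      have hf := h.fixed_of_inversion hy hxy (by order)
      refine hc ⟨hy, ?_, hf⟩
      by_contra! hlt
      have := h.apply_le_of_lt hlt hxy.le
      order

theorem Ascending.card_inversions {hr : Odd r} {σ : Equiv.Perm (Fin r)} (h : Ascending hr σ) :
    (Finset.univ.filter fun p : Fin r × Fin r => p.1 < p.2 ∧ σ p.2 < σ p.1).card
      + (moved σ).card = 2 * ((lastIdx hr : ℕ) - σ (lastIdx hr)) := by
  have h1 : (Finset.univ.filter fun p : Fin r × Fin r => p.1 < p.2 ∧ σ p.2 < σ p.1).card =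
      ∑ y, (Finset.univ.filter fun x => x < y ∧ σ y < σ x).card := by
    simp only [Finset.card_filter]
    rw [Fintype.sum_prod_type_right]
  have h2 : (moved σ).card = ((Finset.Ico (σ (lastIdx hr)) (lastIdx hr)).filter
      fun y => ¬ σ y = y).card := by
    rw [← Finset.card_image_of_injective _ incl_injective]
    congr 1
    ext y
    simp only [Finset.mem_image, mem_moved, Finset.mem_filter, Finset.mem_Ico]
    constructor
    · rintro ⟨i, hi, rfl⟩
      refine ⟨⟨?_, incl_lt_lastIdx hr i⟩, hi⟩
      by_contra! hlt
      exact hi (h.fixed_of_lt hlt)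
    · rintro ⟨⟨-, hy⟩, hne⟩
      obtain ⟨i, rfl⟩ := exists_incl hr hy.ne
      exact ⟨i, hne, rfl⟩
  have h3 : (Finset.univ.filter fun y => y ≠ lastIdx hr ∧ σ (lastIdx hr) ≤ y ∧ σ y = y).card =
      ((Finset.Ico (σ (lastIdx hr)) (lastIdx hr)).filter fun y => σ y = y).card := by
    congr 1
    ext y
    have : y ≠ lastIdx hr ↔ y < lastIdx hr := ⟨lt_lastIdx hr, ne_of_lt⟩
    simp only [Finset.mem_filter, Finset.mem_univ, Finset.mem_Ico, this]
    tauto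
  -- The interval [σ r, r) splits into fixed and moved points. Adding the number of moved points
  -- completes the fixed points to its full length, which doubles the contribution of the last
  -- index.
  rw [h1, Finset.sum_congr rfl fun y _ => h.card_inversions_at y, Finset.sum_add_distrib,
    Finset.sum_ite_eq' Finset.univ, if_pos (Finset.mem_univ _), ← Finset.card_filter, h2, h3,
    add_assoc, Finset.card_filter_add_card_filter_not, Fin.card_Ico]
  omega

/-- The positive root attached to a pair of indices that an element with the signs of `c_I`
keeps positive as soon as the pair is an inversion of the underlying permutation. -/
noncomputable def twistedRoot (hr : Odd r) (p : Fin r × Fin r) : Fin r → ℝ :=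
  if p.2 = lastIdx hr then e p.1 + e p.2 else e p.1 - e p.2

theorem noninversions_eq_image {hr : Odd r} {u : weylD r} {σ : Equiv.Perm (Fin r)}
    (hu : u.1 = signedPerm σ (fun j => if j = lastIdx hr then 1 else -1)) :
    noninversions u = twistedRoot hr '' {p : Fin r × Fin r | p.1 < p.2 ∧ σ p.2 < σ p.1} := by
  ext x
  constructor
  · rintro ⟨⟨i, j, hij, rfl | rfl⟩, h⟩
    · rw [signed_apply_sub hu hij] at h
      split_ifs at h with hj
      · exact absurd h (neg_sub_notMem_posRoots _ _)
      · exact ⟨(i, j), ⟨hij, sub_mem_posRoots_iff.mp h⟩, by simp [twistedRoot, hj]⟩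
    · rw [signed_apply_add hu hij] at h
      split_ifs at h with hj
      · exact ⟨(i, j), ⟨hij, sub_mem_posRoots_iff.mp h⟩, by simp [twistedRoot, hj]⟩
      · exact absurd h (neg_sub_notMem_posRoots _ _)
  · rintro ⟨⟨i, j⟩, ⟨hij, hσ⟩, rfl⟩
    dsimp only at hij hσ
    simp only [twistedRoot]
    split_ifs with hj
    · refine ⟨add_mem_posRoots hij.ne, ?_⟩
      rw [signed_apply_add hu hij, if_pos hj]
      exact sub_mem_posRoots hσ
    · refine ⟨sub_mem_posRoots hij, ?_⟩
      rw [signed_apply_sub hu hij, if_neg hj]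
      exact sub_mem_posRoots hσ

theorem twistedRoot_injOn (hr : Odd r) :
    Set.InjOn (twistedRoot hr) {p : Fin r × Fin r | p.1 < p.2} := by
  rintro ⟨i, j⟩ hij ⟨k, l⟩ hkl h
  simp only [Set.mem_ofPred_eq] at hij hkl
  simp only [twistedRoot] at h
  split_ifs at h
  · obtain ⟨rfl, rfl⟩ := add_eq_add_of_lt hij hkl h
    rfl
  · exact (sub_ne_add hkl h.symm).elim
  · exact (sub_ne_add hij h).elim
  · obtain ⟨rfl, rfl⟩ := sub_eq_sub_of_lt hij h
    rfl

theorem noninversions_ncard {hr : Odd r} {u : weylD r} {σ : Equiv.Perm (Fin r)}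
    (hu : u.1 = signedPerm σ (fun j => if j = lastIdx hr then 1 else -1)) :
    (noninversions u).ncard =
      (Finset.univ.filter fun p : Fin r × Fin r => p.1 < p.2 ∧ σ p.2 < σ p.1).card := by
  rw [noninversions_eq_image hu,
    ((twistedRoot_injOn hr).mono fun p hp => hp.1).ncard_image, ← Set.ncard_coe_finset]
  congr 1
  ext p
  simp

theorem noninversions_cElt (hr : Odd r) {I : Finset (Fin (r - 1))} (hI : I.Nonempty) :
    (noninversions (cElt hr I)).ncard + I.card = 2 * (r - 1 - I.min' hI) := by
  have := (cyc_ascending hr I).card_inversions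
  rw [moved_cyc, cyc_lastIdx hr hI] at this
  rw [noninversions_ncard (cElt_val hr I), this]
  rfl

theorem noninversions_cElt_empty (hr : Odd r) : (noninversions (cElt hr ∅)).ncard = 0 := by
  have := (cyc_ascending hr ∅).card_inversions
  rw [noninversions_ncard (cElt_val hr ∅)]
  simp [cyc_empty] at this
  simpa [cyc_empty] using this.1

theorem noninversions_dElt (hr : Odd r) {I : Finset (Fin (r - 1))} (hI : I.Nonempty) :
    (noninversions (dElt hr I hI)).ncard = (noninversions (cElt hr I)).ncard := by
  rw [dElt_eq_flipConj, noninversions_flipConj_ncard]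

/-! ### Enumeration of the rational elements -/

theorem e_injective : Function.Injective (e : Fin r → Fin r → ℝ) := by
  intro i j h
  by_contra hne
  have := congrFun h i
  simp [e_apply, hne] at this

theorem e_ne_neg (i j : Fin r) : e i ≠ -e j := by
  intro h
  have := congrFun h i
  simp only [e_apply, Pi.neg_apply, if_true] at this
  split_ifs at this <;> norm_num at this

theorem cElt_injective (hr : Odd r) :
    Function.Injective (cElt hr : Finset (Fin (r - 1)) → weylD r) := by
  intro I J h
  have h1 : cyc hr I = cyc hr J := by
    ext1 j
    have h2 := congrArg (fun u : weylD r => u.1 (e j)) h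
    simp only [cElt_val, signedPerm_e] at h2
    refine e_injective ?_
    split_ifs at h2 <;> simpa using h2
  rw [← moved_cyc hr I, h1, moved_cyc]

/-- The list of the rational elements. -/
noncomputable def rationalElt (hr : Odd r) :
    Finset (Fin (r - 1)) ⊕ {I : Finset (Fin (r - 1)) // I.Nonempty} → weylD r :=
  Sum.elim (cElt hr) fun I => dElt hr I.1 I.2

theorem rationalElt_injective (hr : Odd r) : Function.Injective (rationalElt hr) := by
  refine (cElt_injective hr).sumElim ?_ ?_
  · rintro ⟨I, hI⟩ ⟨J, hJ⟩ h
    simp only [dElt_eq_flipConj] at h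
    have h1 := congrArg (flipConj hr) h
    rw [flipConj_flipConj, flipConj_flipConj] at h1
    exact Subtype.ext (cElt_injective hr h1)
  · rintro I ⟨J, hJ⟩ h
    -- The image of e_r has a plus sign for c_I and a minus sign for d_J.
    have h2 := congrArg (fun u : weylD r => u.1 (e (lastIdx hr))) h
    simp only [cElt_val, dElt_val, signedPerm_e, if_true,
      if_neg (incl_lt_lastIdx hr (J.max' hJ)).ne'] at h2
    exact e_ne_neg (cyc hr I (lastIdx hr)) (cyc hr J (lastIdx hr)) (by simpa using h2)

theorem range_rationalElt (hr : Odd r) :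
    Set.range (rationalElt hr) = {u : weylD r | IsRational u} := by
  ext u
  simp only [rationalElt, Set.Sum.elim_range, Set.mem_union, Set.mem_range, Subtype.exists,
    Set.mem_ofPred_eq, isRational_iff hr]
  simp only [eq_comm]

/-! ### The defect generating function -/

section GeneratingFunction

open Polynomial

theorem min'_insert_of_subset_Ioi {n : ℕ} {m : Fin n} {J : Finset (Fin n)}
    (hJ : J ⊆ Finset.Ioi m) : (insert m J).min' (Finset.insert_nonempty _ _) = m := by
  refine le_antisymm (Finset.min'_le _ _ (Finset.mem_insert_self _ _))
    (Finset.le_min' _ _ _ fun j hj => ?_)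
  rcases Finset.mem_insert.mp hj with rfl | hj
  · exact le_rfl
  · exact (Finset.mem_Ioi.mp (hJ hj)).le

/-- Subsets with least element `m` are the sets `insert m J` with `J` above `m`. -/
theorem sum_nonempty_eq_sum_insert {n : ℕ} {M : Type*} [AddCommMonoid M]
    (f : Finset (Fin n) → M) :
    ∑ I : {I : Finset (Fin n) // I.Nonempty}, f I.1 =
      ∑ m : Fin n, ∑ J ∈ (Finset.Ioi m).powerset, f (insert m J) := by
  rw [Finset.sum_sigma' Finset.univ (fun m : Fin n => (Finset.Ioi m).powerset)
    (fun m J => f (insert m J))]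
  refine Finset.sum_bij' (fun I _ => ⟨I.1.min' I.2, I.1.erase (I.1.min' I.2)⟩)
    (fun p _ => ⟨insert p.1 p.2, Finset.insert_nonempty _ _⟩) ?_ ?_ ?_ ?_ ?_
  · rintro ⟨I, hI⟩ -
    simp only [Finset.mem_sigma, Finset.mem_univ, true_and, Finset.mem_powerset]
    intro j hj
    rw [Finset.mem_Ioi]
    exact Finset.min'_lt_of_mem_erase_min' _ _ hj
  · simp
  · rintro ⟨I, hI⟩ -
    simp [Finset.insert_erase (I.min'_mem hI)]
  · rintro ⟨m, J⟩ h
    have hJ : J ⊆ Finset.Ioi m := by simpa using h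
    have hmJ : m ∉ J := fun h => lt_irrefl _ (Finset.mem_Ioi.mp (hJ h))
    have hm := min'_insert_of_subset_Ioi hJ
    simp [hm, Finset.erase_insert hmJ]
  · rintro ⟨I, hI⟩ -
    simp [Finset.insert_erase (I.min'_mem hI)]

/-- If n admissible indices lie above the minimum, then I = {m} ∪ J with J any subset of them, and
the defect is 2n + 1 - #J = (n + 1) + (n - #J). The binomial theorem sums over J; reversing the
order of summation replaces m by n. -/
theorem sum_nonempty_X_pow (hr : Odd r) :
    ∑ I : {I : Finset (Fin (r - 1)) // I.Nonempty},
        (X : ℤ[X]) ^ (noninversions (cElt hr I.1)).ncard =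
      ∑ n ∈ Finset.range (r - 1), X ^ (n + 1) * (1 + X) ^ n := by
  rw [sum_nonempty_eq_sum_insert (fun I => (X : ℤ[X]) ^ (noninversions (cElt hr I)).ncard),
    ← Finset.sum_range_reflect, Finset.sum_range]
  refine Finset.sum_congr rfl fun m _ => ?_
  have hcard : (Finset.Ioi m).card = r - 1 - 1 - m := by rw [Fin.card_Ioi]
  rw [← hcard, ← Finset.sum_pow_mul_eq_add_pow, Finset.mul_sum]
  refine Finset.sum_congr rfl fun J hJ => ?_
  rw [Finset.mem_powerset] at hJ
  have h1 := noninversions_cElt hr (Finset.insert_nonempty m J)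
  have hmJ : m ∉ J := fun h => lt_irrefl _ (Finset.mem_Ioi.mp (hJ h))
  rw [min'_insert_of_subset_Ioi hJ, Finset.card_insert_of_notMem hmJ] at h1
  have h2 := Finset.card_le_card hJ
  have := m.2
  rw [one_pow, one_mul, ← pow_add]
  congr 1
  omega

theorem finsum_rational (hr : Odd r) :
    ∑ᶠ (u : weylD r) (_ : IsRational u), (X : ℤ[X]) ^ (noninversions u).ncard
      = 1 + 2 * ∑ n ∈ Finset.range (r - 1), X ^ (n + 1) * (1 + X) ^ n := by
  change ∑ᶠ (u : weylD r) (_ : u ∈ {u : weylD r | IsRational u}), _ = _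
  rw [← range_rationalElt hr, finsum_mem_range (rationalElt_injective hr),
    finsum_eq_sum_of_fintype, Fintype.sum_sum_type]
  simp only [rationalElt, Sum.elim_inl, Sum.elim_inr, noninversions_dElt]
  have h : ∑ I : Finset (Fin (r - 1)), (X : ℤ[X]) ^ (noninversions (cElt hr I)).ncard =
      1 + ∑ I : {I : Finset (Fin (r - 1)) // I.Nonempty},
        (X : ℤ[X]) ^ (noninversions (cElt hr I.1)).ncard := by
    rw [← Finset.add_sum_erase _ _ (Finset.mem_univ ∅), noninversions_cElt_empty, pow_zero]
    congr 1
    refine Finset.sum_subtype _ (fun I => ?_) _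
    simp [Finset.nonempty_iff_ne_empty]
  rw [h, sum_nonempty_X_pow hr]
  ring

theorem ncard_rational (hr : Odd r) (t : ℕ) :
    ({u : weylD r | IsRational u ∧ (noninversions u).ncard = t}.ncard : ℤ) =
      (if t = 0 then 1 else 0) +
      2 * ∑ n ∈ Finset.range (r - 1), if n + 1 ≤ t then (n.choose (t - (n + 1)) : ℤ) else 0 := by
  classical
  have hfin : {u : weylD r | IsRational u}.Finite := Set.toFinite _
  have h := congrArg (fun p : ℤ[X] => p.coeff t) (finsum_rational hr)
  have hl : ∑ᶠ (u : weylD r) (_ : IsRational u), (X : ℤ[X]) ^ (noninversions u).ncard =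
      ∑ u ∈ hfin.toFinset, X ^ (noninversions u).ncard :=
    finsum_mem_eq_finite_toFinset_sum _ hfin
  rw [hl] at h
  simp only [finsetSum_coeff, coeff_X_pow, coeff_add, coeff_one, coeff_ofNat_mul,
    coeff_X_pow_mul', coeff_one_add_X_pow] at h
  have hc : ({u : weylD r | IsRational u ∧ (noninversions u).ncard = t}.ncard : ℤ) =
      ∑ u ∈ hfin.toFinset, if t = (noninversions u).ncard then 1 else 0 := by
    rw [Finset.sum_boole, ← Set.ncard_coe_finset]
    congr 2
    ext u
    simp [eq_comm]
  rw [hc, h]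

end GeneratingFunction

/-! ### The coefficients a_t -/

theorem ceil_half_le_iff (t n : ℕ) : ⌈((t : ℚ) - 1) / 2⌉₊ ≤ n ↔ t ≤ 2 * n + 1 := by
  rw [Nat.ceil_le, div_le_iff₀ two_pos, sub_le_iff_le_add]
  constructor
  · intro h
    have : (t : ℚ) ≤ ((2 * n + 1 : ℕ) : ℚ) := by push_cast; linarith
    exact_mod_cast this
  · intro h
    have : (t : ℚ) ≤ ((2 * n + 1 : ℕ) : ℚ) := by exact_mod_cast h
    push_cast at this
    linarith

theorem sum_range_choose_eq_a (r t : ℕ) (hr : 2 ≤ r) (ht : 1 ≤ t) :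
    ∑ n ∈ Finset.range (r - 1), (if n + 1 ≤ t then n.choose (t - (n + 1)) else 0) = a r t := by
  unfold a
  symm
  have hmem : ∀ n : ℕ, n ∈ Finset.Icc ⌈((t : ℚ) - 1) / 2⌉₊ (min (t - 1) (r - 2)) ↔
      t ≤ 2 * n + 1 ∧ n + 1 ≤ t ∧ n < r - 1 := by
    intro n
    rw [Finset.mem_Icc, ceil_half_le_iff]
    omega
  refine Finset.sum_subset_zero_on_sdiff (fun n hn => ?_) (fun n hn => ?_) fun n hn => ?_
  · exact Finset.mem_range.mpr ((hmem n).mp hn).2.2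
  · rw [Finset.mem_sdiff, hmem, Finset.mem_range] at hn
    split_ifs with h
    -- Below the ceiling n < (t - 1)/2, so t - n - 1 exceeds n.
    · exact Nat.choose_eq_zero_of_lt (by omega)
    · rfl
  · rw [if_pos ((hmem n).mp hn).2.1, Nat.sub_sub]

theorem a_pos_iff (r t : ℕ) (hr : 2 ≤ r) (ht : 1 ≤ t) : 0 < a r t ↔ t ≤ 2 * r - 3 := by
  unfold a
  constructor
  · intro h
    obtain ⟨n, hn, -⟩ := Finset.exists_ne_zero_of_sum_ne_zero h.ne'
    rw [Finset.mem_Icc, ceil_half_le_iff] at hn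
    omega
  · intro h
    -- The largest index of the range is the witness: t ≤ 2r - 3 makes its lower entry t - n - 1 at
    -- most n.
    refine Finset.sum_pos' (fun _ _ => Nat.zero_le _) ⟨min (t - 1) (r - 2), ?_, ?_⟩
    · rw [Finset.mem_Icc, ceil_half_le_iff]
      omega
    · exact Nat.choose_pos (by omega)

theorem ncard_rational_zero (hr : Odd r) :
    {u : weylD r | IsRational u ∧ (noninversions u).ncard = 0}.ncard = 1 := by
  have h := ncard_rational hr 0
  have h2 : ∑ n ∈ Finset.range (r - 1),
      (if n + 1 ≤ 0 then (n.choose (0 - (n + 1)) : ℤ) else 0) = 0 :=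
    Finset.sum_eq_zero fun n _ => if_neg (by omega)
  rw [h2, if_pos rfl, mul_zero, add_zero] at h
  exact_mod_cast h

theorem ncard_rational_of_pos (hr : Odd r) (hr2 : 2 ≤ r) {t : ℕ} (ht : 1 ≤ t) :
    {u : weylD r | IsRational u ∧ (noninversions u).ncard = t}.ncard = 2 * a r t := by
  have h := ncard_rational hr t
  rw [if_neg (by omega), zero_add] at h
  rw [← sum_range_choose_eq_a r t hr2 ht]
  exact_mod_cast h

theorem exists_rational_iff (hr : Odd r) (hr2 : 2 ≤ r) {t : ℕ} (ht : 1 ≤ t) :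
    (∃ u : weylD r, IsRational u ∧ (noninversions u).ncard = t) ↔ t ≤ 2 * r - 3 := by
  have h := ncard_rational_of_pos hr hr2 ht
  have h2 := Set.ncard_pos (s := {u : weylD r | IsRational u ∧ (noninversions u).ncard = t})
  rw [← a_pos_iff r t hr2 ht]
  change Set.Nonempty {u : weylD r | IsRational u ∧ (noninversions u).ncard = t} ↔ _
  rw [← h2]
  omega

end TypeD

/-! ### Assembly of the statements on defects -/

theorem corollary10p1 (r : ℕ) (hr5 : 5 ≤ r) (hr : Odd r) :
    -- all defects `N - ℓ(u)`, with `N = r (r - 1)`, are non-negative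
    (∀ u : TypeD.weylD r, TypeD.length u ≤ r * (r - 1)) ∧
    -- the defect generating function, a polynomial in `q = X`
    (∑ᶠ (u : TypeD.weylD r) (_ : TypeD.IsRational u),
        (Polynomial.X : Polynomial ℤ) ^ (r * (r - 1) - TypeD.length u)
      = 1 + 2 * ∑ n ∈ Finset.range (r - 1),
          Polynomial.X ^ (n + 1) * (1 + Polynomial.X) ^ n) ∧
    -- the lengths of `c_I` and `d_I`; the least element of `I` is the number `I.min' hI + 1`
    (∀ (I : Finset (Fin (r - 1))) (hI : I.Nonempty),
      (TypeD.length (TypeD.cElt hr I) : ℤ)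
          = r * (r - 1) - (2 * r - 2 * (((I.min' hI : ℕ) : ℤ) + 1) - I.card) ∧
      (TypeD.length (TypeD.dElt hr I hI) : ℤ)
          = r * (r - 1) - (2 * r - 2 * (((I.min' hI : ℕ) : ℤ) + 1) - I.card)) ∧
    -- the number of rational elements of each defect
    ({u : TypeD.weylD r |
        TypeD.IsRational u ∧ (r * (r - 1) : ℤ) - TypeD.length u = 0}.ncard = 1) ∧
    (∀ t : ℕ, 1 ≤ t →
      {u : TypeD.weylD r |
        TypeD.IsRational u ∧ (r * (r - 1) : ℤ) - TypeD.length u = t}.ncard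
          = 2 * TypeD.a r t) ∧
    -- the non-zero defects that occur
    ({δ : ℤ | δ ≠ 0 ∧ ∃ u : TypeD.weylD r,
        TypeD.IsRational u ∧ (r * (r - 1) : ℤ) - TypeD.length u = δ}
      = Set.Icc 1 (2 * (r : ℤ) - 3)) := by
  have hlen := fun u : TypeD.weylD r => TypeD.length_add_noninversions u
  have hN : (((r * (r - 1) : ℕ) : ℤ)) = r * (r - 1) := by
    rw [Nat.cast_mul, Nat.cast_sub (by omega), Nat.cast_one]
  have hdef : ∀ u : TypeD.weylD r,
      (r * (r - 1) : ℤ) - TypeD.length u = (TypeD.noninversions u).ncard := by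
    intro u
    have := hlen u
    rw [← hN]
    omega
  have hr2 : 2 ≤ r := by omega
  refine ⟨fun u => by have := hlen u; omega, ?_, ?_, ?_, ?_, ?_⟩
  · rw [← TypeD.finsum_rational hr]
    refine finsum_congr fun u => finsum_congr fun _ => ?_
    congr 1
    have := hlen u
    omega
  · intro I hI
    have h1 := TypeD.noninversions_cElt hr hI
    have h2 := TypeD.noninversions_dElt hr hI
    have h3 := hdef (TypeD.cElt hr I)
    have h4 := hdef (TypeD.dElt hr I hI)
    have h5 := (I.min' hI).2
    constructor <;> omega
  · simp only [hdef, Nat.cast_eq_zero]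
    exact TypeD.ncard_rational_zero hr
  · intro t ht
    simp only [hdef, Nat.cast_inj]
    exact TypeD.ncard_rational_of_pos hr hr2 ht
  · ext δ
    simp only [hdef, Set.mem_ofPred_eq, Set.mem_Icc]
    constructor
    · rintro ⟨h0, u, hu, rfl⟩
      have ht : 1 ≤ (TypeD.noninversions u).ncard := by omega
      have := (TypeD.exists_rational_iff hr hr2 ht).mp ⟨u, hu, rfl⟩
      omega
    · rintro ⟨h1, h2⟩
      lift δ to ℕ using by omega
      obtain ⟨u, hu, h⟩ :=
        (TypeD.exists_rational_iff hr hr2 (t := δ) (by omega)).mpr (by omega)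
      exact ⟨by omega, u, hu, by rw [h]⟩
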